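/- **Setting.** For $a\in\mathbb Z$ let $g_a(x)=(x+a)^2-a-2$. Its critical point $-a$ has the post-critical orbit $\gamma_1=-a-2\mapsto\gamma_2=2-a\mapsto\gamma_2$. For a prime $p$, the *type* of an irreducible $h\in\mathbb F_p[x]$ is the word of length $2$ whose $i$-th letter is $s$ if $h(\gamma_i)$ is a square in $\mathbb F_p$ and $n$ otherwise; the *factorization type* of a polynomial is the formal product of the symbols $[\text{type},\text{degree}]$ over its irreducible factors. *Model 4.* The level $1$ data are the weighted formal products $([ss,2],\tfrac12)$, $([nn,1]^2,\tfrac14)$, $([ss,1]^2,\tfrac14)$. The level $n+1$ data arise from the level $n$ data by replacing, independently, each factor by its children, following the Markov process of $g_a$ at primes $\equiv 1 \pmod 4$: a factor $[t_1t_2,d]$ with $t_1=n$ is replaced by $[t_2t_2,2d]$; if $t_1=s$, it is replaced by $[T,d][T',d]$ with $TT'=t_2t_2$ (letterwise, $ss=nn=s$, $sn=ns=n$) and the last letter of each of $T,T'$ equal to the first letter of the other, all such pairs being equally likely. Explicitly, $[nn,d]\to[nn,2d]$, $[ns,d]\to[ss,2d]$, $[sn,d]\to[ns,d][sn,d]$,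 and $[ss,d]\to[nn,d]^2$ or $[ss,d]^2$ with probability $\tfrac12$ each. The level $n$ *cycle data* consist of the partitions of $2^n$ (multisets of degrees) that occur at level $n$, each with its total weight. *The groups.* Let $T_n$ be the complete binary rooted tree of height $n$ with leaves $1,\dots,2^n$ from left to right, $W_n=\mathrm{Aut}(T_n)\le S_{2^n}$, and view $W_i\le W_n$ for $i\le n$ (acting on $1,\dots,2^i$, fixing the other leaves). Permutations are composed from right to left. Put $a_i=(1,2^{i-1}+1)(2,2^{i-1}+2)\cdots(2^{i-1},2^i)$, $x_i=a_1a_2\cdots a_i$ ($x_0=1$), $v_i=x_{i+2}^2$, $m_1=1$, and $m_n=a_{n-1}\,x_nx_{n-2}x_n^{-1}$ for $n\ge2$. Let $M_n=\langle x_n,m_n,v_0,\dots,v_{n-3}\rangle$ (no $v_i$ if $n\le 2$), let $N_n$ be the normal closure of $\langle m_n,v_0,\dots,v_{n-3}\rangle$ in $M_n$, let $N_n^{od}$ be the set of $g\in N_n$ for which $x_ng$ is transitive on the leaves of $T_n$, and let $M_n(2)=\langle x_nm_n,\ N_n^{od}\rangle$. **Corollary 5.18.** Let $a=2+b^2$ or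 $a=2-b^2$ with $b\in\mathbb Z$, and suppose that $g_a$ is irreducible. For every prime $p\equiv1\pmod 4$ the factorization type of $g_a$ modulo $p$ is one of $[ss,2]$, $[nn,1]^2$, $[ss,1]^2$. Moreover, for every $n\ge1$, $M_n(2)$ is a subgroup of $\mathrm{Aut}(T_n)$ and satisfies Model 4: the cycle types (fixed points included) that occur in $M_n(2)$, each with the proportion of elements of $M_n(2)$ having it, are exactly the level $n$ cycle data of Model 4. -/

import Mathlib

open Polynomial

namespace EvenMarkov

/-! ### The polynomials and the types of their factors modulo primes -/

/-- `g_a(x) = (x + a)² - a - 2`. -/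
noncomputable def gPoly (a : ℤ) : ℤ[X] := (X + C a) ^ 2 - C a - 2

/-- `postcrit a k` is `g_a^k(c)`, where `c = -a` is the critical point of `g_a`. -/
noncomputable def postcrit (a : ℤ) (k : ℕ) : ℤ := (fun z => (gPoly a).eval z)^[k] (-a)

/-- The critical point `-a` is strictly preperiodic: the post-critical orbit has the two elements
`γ₁ = g_a(c)`, `γ₂ = g_a²(c)`, with `γ₁ ↦ γ₂ ↦ γ₂`; the tail is `{γ₁}`. -/
theorem postcrit_portrait (a : ℤ) :
    postcrit a 1 ≠ postcrit a 2 ∧ postcrit a 3 = postcrit a 2 := by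
  have h2 : (2 : ℤ[X]) = C 2 := rfl
  constructor
  · simp only [postcrit, gPoly, Function.iterate_succ, Function.iterate_zero, Function.comp, id,
      h2, eval_sub, eval_pow, eval_add, eval_X, eval_C]
    intro h
    ring_nf at h
    omega
  · simp only [postcrit, gPoly, Function.iterate_succ, Function.iterate_zero, Function.comp, id,
      h2, eval_sub, eval_pow, eval_add, eval_X, eval_C]
    ring

/-- A type: a string of length two, first entry at `γ₁`, second entry at `γ₂`.
The letter `s` (square) is `true`, the letter `n` (not a square) is `false`. -/
abbrev FType := Bool × Bool

/-- The type `nn`. -/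
def nn : FType := (false, false)

/-- The type `ss`. -/
def ss : FType := (true, true)

open Classical in
/-- The type of a polynomial `h` over `𝔽_p`: which of `h(γ₁)`, `h(γ₂)` are squares in `𝔽_p`. -/
noncomputable def typeOf (a : ℤ) (p : ℕ) (h : (ZMod p)[X]) : FType :=
  (decide (IsSquare (h.eval ((postcrit a 1 : ℤ) : ZMod p))),
   decide (IsSquare (h.eval ((postcrit a 2 : ℤ) : ZMod p))))

open Classical in
/-- The factorization type of `g_a` modulo `p`: the formal product of `[type, degree]` over the
irreducible factors, as a multiset. -/
noncomputable def factType (a : ℤ) (p : ℕ) [Fact p.Prime] : Multiset (FType × ℕ) :=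
  (UniqueFactorizationMonoid.normalizedFactors
    ((gPoly a).map (Int.castRingHom (ZMod p)))).map (fun h => (typeOf a p h, h.natDegree))

/-! ### The Markov process of `g_a` at the primes congruent to `1` modulo `4` -/

/-- The action of `g_a` on types: the entry of the new type at `γ` is the entry of the old one at
`g_a(γ)`, and `γ₁ ↦ γ₂ ↦ γ₂`. -/
def act (T : FType) : FType := (T.2, T.2)

/-- Entrywise product of types, with the sign rule `ss = nn = s`, `sn = ns = n` for letters. -/
def mulType (T₁ T₂ : FType) : FType := (T₁.1 == T₂.1, T₁.2 == T₂.2)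

/-- The allowable (ordered) pairs of types of the two children of a factor of type `T` starting
with `s`: their product is `act T`, and, as `g_a` has post-critical orbit of size `2` and tail of
size `1`, the last digit of each child is the first digit of the other. -/
def allowable (T : FType) : Finset (FType × FType) :=
  Finset.univ.filter fun P =>
    mulType P.1 P.2 = act T ∧ P.1.2 = P.2.1 ∧ P.2.2 = P.1.1

theorem allowable_nonempty (T : FType) : (allowable T).Nonempty := by
  revert T
  decide

/-- A formal product `∏ [tᵢ, dᵢ]`, written as a list. Only order-independent
information is ever read off from it. -/
abbrev Datum := List (FType × ℕ)

/-- The random children of a factor `[T, d]`. A type starting with `n` gives the single factor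
`[act T, 2d]`; a type starting with `s` gives two factors `[T₁, d][T₂, d]`, all allowable pairs
`(T₁, T₂)` being equally likely. That is,
`[nn,d] → [nn,2d]`, `[ns,d] → [ss,2d]`, `[sn,d] → [ns,d][sn,d]`, and
`[ss,d] → [nn,d][nn,d]` or `[ss,d][ss,d]`, each with probability `1/2`. -/
noncomputable def children (F : FType × ℕ) : PMF Datum :=
  if F.1.1 = true then
    (PMF.uniformOfFinset (allowable F.1) (allowable_nonempty F.1)).map
      (fun P => [(P.1, F.2), (P.2, F.2)])
  else PMF.pure [(act F.1, 2 * F.2)]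

/-- One step of the Markov process on a formal product: all the factors are replaced,
independently of one another, by their children. -/
noncomputable def step : Datum → PMF Datum
  | [] => PMF.pure []
  | F :: L => (children F).bind fun D => (step L).map fun E => D ++ E

/-- The three formal products `[ss,2]`, `[nn,1][nn,1]`, `[ss,1][ss,1]`. -/
def firstLevel : Finset Datum := {[(ss, 2)], [(nn, 1), (nn, 1)], [(ss, 1), (ss, 1)]}

/-- The weights `1/2`, `1/4`, `1/4` of `[ss,2]`, `[nn,1][nn,1]`, `[ss,1][ss,1]`. -/
noncomputable def firstWeight (D : Datum) : ENNReal :=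
  if D = [(ss, 2)] then 1 / 2
  else if D = [(nn, 1), (nn, 1)] then 1 / 4
  else if D = [(ss, 1), (ss, 1)] then 1 / 4
  else 0

/-- The first level data `([ss,2],1/2), ([nn,1][nn,1],1/4), ([ss,1][ss,1],1/4)`. -/
noncomputable def model4 : PMF Datum :=
  PMF.ofFinset firstWeight firstLevel
    (by
      have h : (4 : ENNReal)⁻¹ + 4⁻¹ = 2⁻¹ := by
        have h4 : (4 : ENNReal) = 2 * 2 := by norm_num
        rw [h4, ENNReal.mul_inv (by simp) (by simp), ← mul_add, ENNReal.inv_two_add_inv_two,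
          mul_one]
      simp [firstLevel, firstWeight, nn, ss, h, ENNReal.inv_two_add_inv_two])
    (by
      intro D hD
      simp only [firstLevel, Finset.mem_insert, Finset.mem_singleton, not_or] at hD
      simp [firstWeight, hD.1, hD.2.1, hD.2.2])

/-- The level `n` data (`n ≥ 1`): the Markov process applied `n - 1` times to the first level. -/
noncomputable def levelData (n : ℕ) : PMF Datum := (fun D => D.bind step)^[n - 1] model4

/-- The partition underlying a formal product: the multiset of the degrees. -/
def degrees (D : Datum) : Multiset ℕ := (D.map Prod.snd : Multiset ℕ)

/-- The level `n` cycle data: the partitions that occur in the level `n` data, each with its total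
weight. -/
def levelCycleData (n : ℕ) : Set (Multiset ℕ × ℝ) :=
  {q | q.1 ∈ ((levelData n).map degrees).support ∧ q.2 = (((levelData n).map degrees) q.1).toReal}

/-! ### Automorphisms of the binary tree and the groups

The leaves of the binary rooted tree `T_n` of height `n` are labelled `0, …, 2^n - 1` from left to
right. The vertices at height `k` above the leaves are the blocks `{j | j / 2^k = q}`. -/

/-- `W_n = Aut(T_n)`, as a group of permutations of the leaves. -/
def treeAut (n : ℕ) : Subgroup (Equiv.Perm (Fin (2 ^ n))) where
  carrier := {w | ∀ (k : ℕ) (i j : Fin (2 ^ n)),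
    (w i : ℕ) / 2 ^ k = (w j : ℕ) / 2 ^ k ↔ (i : ℕ) / 2 ^ k = (j : ℕ) / 2 ^ k}
  mul_mem' := by
    intro u v hu hv k i j
    simp only [Equiv.Perm.mul_apply]
    rw [hu, hv]
  one_mem' := by
    intro k i j
    simp
  inv_mem' := by
    intro u hu k i j
    rw [← hu k (u⁻¹ i) (u⁻¹ j)]
    simp

/-- The map `j ↦ j ± 2^(i-1)` that exchanges `{0,…,2^(i-1)-1}` and `{2^(i-1),…,2^i-1}` and fixes
the other leaves. -/
def exchange (n i : ℕ) (h : 1 ≤ i ∧ i ≤ n) (j : Fin (2 ^ n)) : Fin (2 ^ n) :=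
  if hj : (j : ℕ) < 2 ^ (i - 1) then
    ⟨j + 2 ^ (i - 1), by
      have h1 : 2 ^ i = 2 * 2 ^ (i - 1) := by
        rw [← pow_succ', Nat.sub_add_cancel h.1]
      have h2 : 2 ^ i ≤ 2 ^ n := Nat.pow_le_pow_right (by norm_num) h.2
      omega⟩
  else if (j : ℕ) < 2 ^ i then
    ⟨j - 2 ^ (i - 1), lt_of_le_of_lt (Nat.sub_le _ _) j.isLt⟩
  else j

theorem exchange_involutive (n i : ℕ) (h : 1 ≤ i ∧ i ≤ n) :
    Function.Involutive (exchange n i h) := by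
  have h1 : 2 ^ i = 2 * 2 ^ (i - 1) := by
    rw [← pow_succ', Nat.sub_add_cancel h.1]
  intro j
  obtain ⟨j, hj⟩ := j
  by_cases hA : j < 2 ^ (i - 1)
  · have hB : ¬ (j + 2 ^ (i - 1) < 2 ^ (i - 1)) := by omega
    have hC : j + 2 ^ (i - 1) < 2 ^ i := by omega
    simp [exchange, hA, hC]
  · by_cases hC : j < 2 ^ i
    · have hD : j - 2 ^ (i - 1) < 2 ^ (i - 1) := by omega
      have hE : j - 2 ^ (i - 1) + 2 ^ (i - 1) = j := by omega
      simp [exchange, hA, hC, hD, hE]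
    · simp [exchange, hA, hC]

/-- The generator `a_i ∈ W_n`, `1 ≤ i ≤ n`. In `1`-based labels it is
`(1, 2^(i-1)+1)(2, 2^(i-1)+2)⋯(2^(i-1), 2^i)`. -/
def genA (n i : ℕ) : Equiv.Perm (Fin (2 ^ n)) :=
  if h : 1 ≤ i ∧ i ≤ n then (exchange_involutive n i h).toPerm else 1

/-- `x_i = a_1 a_2 ⋯ a_i ∈ W_i`, viewed in `W_n` for `i ≤ n`; permutations are composed from right
to left. -/
def odo (n : ℕ) : ℕ → Equiv.Perm (Fin (2 ^ n))
  | 0 => 1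
  | i + 1 => odo n i * genA n (i + 1)

/-- `v_i = x_{i+2}²`, viewed in `W_n`. -/
def vElt (n i : ℕ) : Equiv.Perm (Fin (2 ^ n)) := odo n (i + 2) ^ 2

/-- `m_1 = 1` and `m_n = a_{n-1} · x_n x_{n-2} x_n⁻¹` for `n ≥ 2`; in particular `m_2 = a_1`. -/
def mElt : (n : ℕ) → Equiv.Perm (Fin (2 ^ n))
  | 0 => 1
  | 1 => 1
  | n + 2 => genA (n + 2) (n + 1) *
      (odo (n + 2) (n + 2) * odo (n + 2) n * (odo (n + 2) (n + 2))⁻¹)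

/-- `M_n = ⟨x_n, m_n, v_{n-3}, …, v_0⟩`. -/
def grpM (n : ℕ) : Subgroup (Equiv.Perm (Fin (2 ^ n))) :=
  Subgroup.closure ({odo n n, mElt n} ∪ {w | ∃ i, i + 3 ≤ n ∧ w = vElt n i})

/-- `H_n = ⟨m_n, v_{n-3}, …, v_0⟩`. -/
def grpH (n : ℕ) : Subgroup (Equiv.Perm (Fin (2 ^ n))) :=
  Subgroup.closure ({mElt n} ∪ {w | ∃ i, i + 3 ≤ n ∧ w = vElt n i})

/-- `N_n`, the normal closure of `H_n` in `M_n`. -/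
def grpN (n : ℕ) : Subgroup (Equiv.Perm (Fin (2 ^ n))) :=
  (Subgroup.normalClosure (((grpH n).subgroupOf (grpM n) : Subgroup (grpM n)) :
    Set (grpM n))).map (grpM n).subtype

/-- `w` is an `n`-odometer: it acts transitively on the leaves of `T_n`
(hence, if it is a tree automorphism, on each level). -/
def IsOdometer (n : ℕ) (w : Equiv.Perm (Fin (2 ^ n))) : Prop :=
  ∀ i j, w.SameCycle i j

/-- `G^od`: the elements `g` of `G` such that `x_n g` is an `n`-odometer. -/
def od (n : ℕ) (G : Subgroup (Equiv.Perm (Fin (2 ^ n)))) : Set (Equiv.Perm (Fin (2 ^ n))) :=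
  {w | w ∈ G ∧ IsOdometer n (odo n n * w)}

/-- `M_n(2) = ⟨x_n m_n, N_n^od⟩`. -/
def grpM2 (n : ℕ) : Subgroup (Equiv.Perm (Fin (2 ^ n))) :=
  Subgroup.closure ({odo n n * mElt n} ∪ od n (grpN n))

/-- The cycle type of a permutation, fixed points included. -/
def cyc {n : ℕ} (w : Equiv.Perm (Fin (2 ^ n))) : Multiset ℕ := w.partition.parts

/-- The cycle data of `G`: the cycle types that occur in `G`, each with the proportion of the
elements of `G` that have it. -/
def cycleData {n : ℕ} (G : Subgroup (Equiv.Perm (Fin (2 ^ n)))) : Set (Multiset ℕ × ℝ) :=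
  {q | (∃ w ∈ G, cyc w = q.1) ∧
    q.2 = (Nat.card {w : G // cyc (w : Equiv.Perm (Fin (2 ^ n))) = q.1} : ℝ) / (Nat.card G : ℝ)}

end EvenMarkov

namespace EvenMarkov

/-! ### The factorization of `g_a` modulo a prime congruent to `1` modulo `4` -/

/-! Modulo `p`, `g_a` is `(x + a)² - (a + 2)`. When `-1` is a square, the choice of `a` makes `2 -
a` a square. If `a + 2` is not a square, `g_a` is irreducible with value `2 - a` at both
post-critical points. If `a + 2 = c²`, signs do not matter and the values of each linear factor are
`2 + c` and `2 - c` in some order, with product `2 - a`; so all letters agree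
(`factType_mem_firstLevel`).

The group side rests on a recursively defined group `K_n` (`grpK`): an element of `K_(n+1)` acts on
the two half trees by a pair taken from `K_n × K_n` or from `x_n K_n × x_n K_n`. Every element of
`x_n K_n` is a full cycle (`cyc_odo_mul`). Hence, for `n ≥ 1`, a random element of `K_(n+1)` has,
with probability `1/2` each, two cycles of length `2^n` or the cycles of two independent random
elements of `K_n`. This is the rule by which `[ss,d]` becomes `[nn,d]²`, whose factors only double
from then on, or `[ss,d]²`. So `K_n` has the degree distribution of `[ss,1]` after `n` steps, called
`branch n 1` (`uniformOfFintype_grpK_map_cyc`).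

For `n ≥ 2`, `N_n^od = K_n` (`od_grpN`): `N_n` lies between `K_n` and `K_n ∪ m_n K_n`, and `x_n m_n
K_n` contains no full cycle. Thus `M_n(2) = K_n ∪ x_n m_n K_n`. The second coset exchanges the
halves; its cycle types are the doubled cycle types of uniform elements of `K_(n-1)`, matching the
descendants of `[ss,2]`. Model 4 likewise starts with a fair coin between `[ss,2]` and the children
of `[ss,1]` (`model4_eq`), so the two laws agree (`uniformOfFintype_grpM2_map_cyc`). -/

theorem postcrit_one (a : ℤ) : postcrit a 1 = -a - 2 := by
  have h2 : (2 : ℤ[X]) = C 2 := rfl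
  simp only [postcrit, gPoly, Function.iterate_succ, Function.iterate_zero, Function.comp, id,
    h2, eval_sub, eval_pow, eval_add, eval_X, eval_C]
  ring

theorem postcrit_two (a : ℤ) : postcrit a 2 = 2 - a := by
  have h2 : (2 : ℤ[X]) = C 2 := rfl
  simp only [postcrit, gPoly, Function.iterate_succ, Function.iterate_zero, Function.comp, id,
    h2, eval_sub, eval_pow, eval_add, eval_X, eval_C]
  ring

theorem gPoly_map (a : ℤ) (p : ℕ) :
    (gPoly a).map (Int.castRingHom (ZMod p)) =
      (X + C (a : ZMod p)) ^ 2 - C ((a : ZMod p) + 2) := by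
  have h2 : (2 : ℤ[X]) = C 2 := rfl
  simp only [gPoly, h2, Polynomial.map_sub, Polynomial.map_pow, Polynomial.map_add, map_X, map_C,
    C_add]
  simp
  ring

theorem monic_sq_sub_C {F : Type*} [Field F] (a c : F) : ((X + C a) ^ 2 - C c).Monic := by
  have : (X + C a) ^ 2 - C c = X ^ 2 + C (2 * a) * X + C (a ^ 2 - c) := by
    simp only [C_mul, C_sub, C_pow]
    have : (C 2 : F[X]) = 2 := rfl
    rw [this]
    ring
  rw [this]
  monicity!

theorem natDegree_sq_sub_C {F : Type*} [Field F] (a c : F) :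
    ((X + C a) ^ 2 - C c).natDegree = 2 := by
  rw [natDegree_sub_C, natDegree_pow, natDegree_X_add_C]

theorem irreducible_sq_sub_C {F : Type*} [Field F] (a c : F) (hc : ¬ IsSquare c) :
    Irreducible ((X + C a) ^ 2 - C c) := by
  rw [irreducible_iff_roots_eq_zero_of_degree_le_three (natDegree_sq_sub_C a c).ge
    (by rw [natDegree_sq_sub_C]; norm_num)]
  rw [Multiset.eq_zero_iff_forall_notMem]
  intro z hz
  have := (mem_roots'.1 hz).2
  simp only [IsRoot, eval_sub, eval_pow, eval_add, eval_X, eval_C] at this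
  exact hc ⟨z + a, by linear_combination -this⟩

theorem factType_mem_firstLevel (a b : ℤ) (hab : a = 2 + b ^ 2 ∨ a = 2 - b ^ 2) (p : ℕ)
    [Fact p.Prime] (hp : p % 4 = 1) :
    ∃ D ∈ firstLevel, factType a p = (D : Multiset (FType × ℕ)) := by
  classical
  obtain ⟨i, hi⟩ : IsSquare (-1 : ZMod p) := ZMod.exists_sq_eq_neg_one_iff.2 (by omega)
  have hsq : IsSquare ((2 : ZMod p) - a) := by
    rcases hab with rfl | rfl
    · exact ⟨i * b, by push_cast; linear_combination (b : ZMod p) ^ 2 * hi⟩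
    · exact ⟨b, by push_cast; ring⟩
  unfold factType
  rw [gPoly_map]
  by_cases hc : IsSquare ((a : ZMod p) + 2)
  · obtain ⟨c, hc⟩ := hc
    have hfac : (X + C (a : ZMod p)) ^ 2 - C ((a : ZMod p) + 2) =
        (X - C (c - a)) * (X - C (-c - a)) := by
      rw [hc]
      simp only [C_mul, C_sub, C_neg]
      ring
    have hneg : ∀ z : ZMod p, IsSquare (-z) ↔ IsSquare z := by
      have key : ∀ z : ZMod p, IsSquare z → IsSquare (-z) := by
        rintro z ⟨t, rfl⟩
        exact ⟨i * t, by linear_combination t ^ 2 * hi⟩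
      exact fun z => ⟨fun h => by simpa using key _ h, key z⟩
    -- The product is `4 - c² = 2 - a`, a square. Dividing needs nonzero factors; if one factor
    -- vanishes, the other is `4`, and both are squares.
    have hiff : IsSquare (2 - c) ↔ IsSquare (2 + c) := by
      have hprod : IsSquare ((2 - c) * (2 + c)) := by
        have : (2 - c) * (2 + c) = 2 - (a : ZMod p) := by linear_combination hc
        rwa [this]
      have h4 : IsSquare (4 : ZMod p) := ⟨2, by norm_num⟩
      rcases eq_or_ne (2 - c) 0 with h | h
      · have : 2 + c = 4 := by linear_combination -h
        simp [h, this, h4]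
      rcases eq_or_ne (2 + c) 0 with h' | h'
      · have : 2 - c = 4 := by linear_combination -h'
        simp [h', this, h4]
      constructor
      · intro hs
        have := hprod.div hs
        rwa [mul_div_cancel_left₀ _ h] at this
      · intro hs
        have := hprod.div hs
        rwa [mul_div_cancel_right₀ _ h'] at this
    have t1 : typeOf a p (X - C (c - a)) =
        (decide (IsSquare (2 + c)), decide (IsSquare (2 + c))) := by
      simp only [typeOf, postcrit_one, postcrit_two, eval_sub, eval_X, eval_C]
      push_cast
      have e1 : -(a : ZMod p) - 2 - (c - a) = -(2 + c) := by ring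
      have e2 : (2 : ZMod p) - a - (c - a) = 2 - c := by ring
      rw [e1, e2]
      simp only [hneg, hiff]
    have t2 : typeOf a p (X - C (-c - a)) =
        (decide (IsSquare (2 + c)), decide (IsSquare (2 + c))) := by
      simp only [typeOf, postcrit_one, postcrit_two, eval_sub, eval_X, eval_C]
      push_cast
      have e1 : -(a : ZMod p) - 2 - (-c - a) = -(2 - c) := by ring
      have e2 : (2 : ZMod p) - a - (-c - a) = 2 + c := by ring
      rw [e1, e2]
      simp only [hneg, hiff]
    have hnf : UniqueFactorizationMonoid.normalizedFactors
        ((X + C (a : ZMod p)) ^ 2 - C ((a : ZMod p) + 2)) =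
          {X - C (c - (a : ZMod p)), X - C (-c - (a : ZMod p))} := by
      rw [hfac, UniqueFactorizationMonoid.normalizedFactors_mul (X_sub_C_ne_zero _)
        (X_sub_C_ne_zero _), UniqueFactorizationMonoid.normalizedFactors_irreducible
        (irreducible_X_sub_C _), UniqueFactorizationMonoid.normalizedFactors_irreducible
        (irreducible_X_sub_C _), (monic_X_sub_C _).normalize_eq_self,
        (monic_X_sub_C _).normalize_eq_self]
      rfl
    rw [hnf]
    by_cases hs : IsSquare (2 + c)
    · refine ⟨[(ss, 1), (ss, 1)], by simp [firstLevel], ?_⟩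
      rw [Multiset.insert_eq_cons, Multiset.map_cons, Multiset.map_singleton, t1, t2,
        natDegree_X_sub_C, natDegree_X_sub_C, decide_eq_true hs]
      rfl
    · refine ⟨[(nn, 1), (nn, 1)], by simp [firstLevel], ?_⟩
      rw [Multiset.insert_eq_cons, Multiset.map_cons, Multiset.map_singleton, t1, t2,
        natDegree_X_sub_C, natDegree_X_sub_C, decide_eq_false hs]
      rfl
  · refine ⟨[(ss, 2)], by simp [firstLevel], ?_⟩
    rw [UniqueFactorizationMonoid.normalizedFactors_irreducible (irreducible_sq_sub_C _ _ hc),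
      (monic_sq_sub_C _ _).normalize_eq_self]
    have ht : typeOf a p ((X + C (a : ZMod p)) ^ 2 - C ((a : ZMod p) + 2)) = ss := by
      simp only [typeOf, postcrit_one, postcrit_two, eval_sub, eval_X, eval_C, eval_pow, eval_add]
      push_cast
      have e1 : (-(a : ZMod p) - 2 + a) ^ 2 - (a + 2) = 2 - a := by ring
      have e2 : ((2 : ZMod p) - a + a) ^ 2 - (a + 2) = 2 - a := by ring
      rw [e1, e2]
      simp [hsq, ss]
    rw [Multiset.map_singleton, ht, natDegree_sq_sub_C]
    rfl

/-! ### Cycle types as multisets of orbit sizes -/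

section Orbits

variable {α β : Type*} [Fintype α] [Fintype β] [DecidableEq α] [DecidableEq β]

/-- The orbit of `i` under the permutation `w`. -/
def orbitOf (w : Equiv.Perm α) (i : α) : Finset α := Finset.univ.filter (w.SameCycle i)

/-- The set of the orbits of the permutation `w`. -/
def orbits (w : Equiv.Perm α) : Finset (Finset α) := Finset.univ.image (orbitOf w)

theorem mem_orbitOf {w : Equiv.Perm α} {i j : α} : j ∈ orbitOf w i ↔ w.SameCycle i j := by
  simp [orbitOf]

/-- Counting orbits treats fixed points and nontrivial cycles alike, so the cycle type of a
permutation built from others can be read off from images of orbits under embeddings. -/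
theorem parts_partition_eq_orbits (w : Equiv.Perm α) :
    w.partition.parts = (orbits w).val.map Finset.card := by
  have hfix : ∀ i ∉ w.support, orbitOf w i = {i} := by
    intro i hi
    ext j
    rw [mem_orbitOf, Finset.mem_singleton]
    refine ⟨fun h => (Equiv.Perm.SameCycle.eq_of_left h ?_).symm, fun h => h ▸ .refl _ _⟩
    exact Equiv.Perm.notMem_support.1 hi
  have hsupp : ∀ i ∈ w.support, orbitOf w i = (w.cycleOf i).support := by
    intro i hi
    ext j
    rw [mem_orbitOf, Equiv.Perm.mem_support_cycleOf_iff' (Equiv.Perm.mem_support.1 hi)]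
  have hcyc : w.cycleFactorsFinset.image Equiv.Perm.support = w.support.image (orbitOf w) := by
    ext O
    simp only [Finset.mem_image]
    constructor
    · rintro ⟨c, hc, rfl⟩
      obtain ⟨i, hi⟩ := (Equiv.Perm.mem_cycleFactorsFinset_iff.1 hc).1.nonempty_support
      have hiw := Equiv.Perm.mem_cycleFactorsFinset_support_le hc hi
      exact ⟨i, hiw, by rw [hsupp i hiw, ← Equiv.Perm.cycle_is_cycleOf hi hc]⟩
    · rintro ⟨i, hi, rfl⟩
      exact ⟨_, Equiv.Perm.cycleOf_mem_cycleFactorsFinset_iff.2 hi, (hsupp i hi).symm⟩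
  have hdisj : Disjoint (w.support.image (orbitOf w)) (w.supportᶜ.image (orbitOf w)) := by
    rw [Finset.disjoint_left]
    intro O h1 h2
    obtain ⟨i, hi, rfl⟩ := Finset.mem_image.1 h1
    obtain ⟨j, hj, hij⟩ := Finset.mem_image.1 h2
    have hj' := Finset.mem_compl.1 hj
    rw [hfix j hj'] at hij
    have : i ∈ orbitOf w i := mem_orbitOf.2 (.refl _ _)
    rw [← hij, Finset.mem_singleton] at this
    exact hj' (this ▸ hi)
  have hunion : orbits w = (w.support.image (orbitOf w)).disjUnion _ hdisj := by
    rw [Finset.disjUnion_eq_union, ← Finset.image_union, Finset.union_compl]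
    rfl
  rw [hunion, Finset.disjUnion_val, Multiset.map_add, Equiv.Perm.parts_partition]
  congr 1
  · rw [← hcyc, Equiv.Perm.cycleType_def, Finset.image_val_of_injOn, Multiset.map_map]
    -- Two cycle factors with the same support are both the cycle of `w` through any common point.
    intro c hc d hd hcd
    obtain ⟨i, hi⟩ := (Equiv.Perm.mem_cycleFactorsFinset_iff.1 hc).1.nonempty_support
    have hi' : i ∈ d.support := hcd ▸ hi
    rw [Equiv.Perm.cycle_is_cycleOf hi hc, Equiv.Perm.cycle_is_cycleOf hi' hd]
  · have : w.supportᶜ.image (orbitOf w) = w.supportᶜ.image (fun i => {i}) :=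
      Finset.image_congr fun i hi => hfix i (by simpa using hi)
    rw [this, Finset.image_val_of_injOn (fun i _ j _ h => Finset.singleton_injective h),
      Multiset.map_map, ← Finset.card_compl]
    simp

theorem parts_partition_permCongr (e : α ≃ β) (w : Equiv.Perm α) :
    (e.permCongr w).partition.parts = w.partition.parts := by
  have h1 : ∀ i, orbitOf (e.permCongr w) (e i) = (orbitOf w i).map e.toEmbedding := by
    intro i
    ext j
    obtain ⟨j, rfl⟩ := e.surjective j
    have hz : ∀ k : ℤ, (e.permCongr w) ^ k = e.permCongr (w ^ k) := fun k =>
      (map_zpow e.permCongrHom w k).symm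
    simp [mem_orbitOf, Equiv.Perm.SameCycle, hz]
  have h2 : orbits (e.permCongr w) = (orbits w).image (Finset.map e.toEmbedding) := by
    ext O
    simp only [orbits, Finset.mem_image, Finset.mem_univ, true_and]
    rw [e.symm.exists_congr_left]
    simp [h1]
  rw [parts_partition_eq_orbits, parts_partition_eq_orbits, h2,
    Finset.image_val_of_injOn ((Finset.map_injective _).injOn), Multiset.map_map]
  simp

theorem parts_partition_sumCongr (u : Equiv.Perm α) (v : Equiv.Perm β) :
    (Equiv.Perm.partition (Equiv.sumCongr u v)).parts = u.partition.parts + v.partition.parts := by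
  have hz : ∀ k : ℤ, (Equiv.sumCongr u v : Equiv.Perm (α ⊕ β)) ^ k =
      Equiv.sumCongr (u ^ k) (v ^ k) := fun k =>
    (map_zpow (Equiv.Perm.sumCongrHom α β) (u, v) k).symm
  have h1 : ∀ i, orbitOf (Equiv.sumCongr u v) (Sum.inl i) =
      (orbitOf u i).map Function.Embedding.inl := by
    intro i
    ext j
    rcases j with j | j <;> simp [mem_orbitOf, Equiv.Perm.SameCycle, hz]
  have h2 : ∀ i, orbitOf (Equiv.sumCongr u v) (Sum.inr i) =
      (orbitOf v i).map Function.Embedding.inr := by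
    intro i
    ext j
    rcases j with j | j <;> simp [mem_orbitOf, Equiv.Perm.SameCycle, hz]
  have hdisj : Disjoint ((orbits u).image (Finset.map Function.Embedding.inl))
      ((orbits v).image (Finset.map (Function.Embedding.inr : β ↪ α ⊕ β))) := by
    rw [Finset.disjoint_left]
    intro O hO hO'
    obtain ⟨A, hA, rfl⟩ := Finset.mem_image.1 hO
    obtain ⟨B, hB, hAB⟩ := Finset.mem_image.1 hO'
    obtain ⟨i, -, rfl⟩ := Finset.mem_image.1 hA
    have : Sum.inl i ∈ (orbitOf u i).map (Function.Embedding.inl : α ↪ α ⊕ β) := by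
      simp [mem_orbitOf, Equiv.Perm.SameCycle.refl]
    rw [← hAB] at this
    simp at this
  have h3 : orbits (Equiv.sumCongr u v) = ((orbits u).image
      (Finset.map Function.Embedding.inl)).disjUnion _ hdisj := by
    ext O
    simp only [orbits, Finset.mem_image, Finset.mem_univ, true_and, Finset.mem_disjUnion,
      Sum.exists, h1, h2, exists_exists_eq_and]
  rw [parts_partition_eq_orbits, parts_partition_eq_orbits, parts_partition_eq_orbits, h3,
    Finset.disjUnion_val, Multiset.map_add,
    Finset.image_val_of_injOn ((Finset.map_injective _).injOn),
    Finset.image_val_of_injOn ((Finset.map_injective _).injOn), Multiset.map_map,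
    Multiset.map_map]
  simp

/-- Composing the exchange of two copies of `α` with `u` on one of them doubles all cycles. -/
theorem parts_partition_sumCongr_one_mul_sumComm (u : Equiv.Perm α) :
    (Equiv.Perm.partition (Equiv.sumCongr u 1 * Equiv.sumComm α α)).parts =
      u.partition.parts.map (2 * ·) := by
  set W : Equiv.Perm (α ⊕ α) := Equiv.sumCongr u 1 * Equiv.sumComm α α with hW
  have hl : ∀ i, W (Sum.inl i) = Sum.inr i := fun i => rfl
  have hr : ∀ i, W (Sum.inr i) = Sum.inl (u i) := fun i => rfl
  have hsq : W ^ 2 = Equiv.sumCongr u u := by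
    ext i
    rcases i with i | i <;> rfl
  have hz : ∀ k : ℤ, W ^ (2 * k) = Equiv.sumCongr (u ^ k) (u ^ k) := by
    intro k
    have : W ^ (2 * k) = (W ^ 2) ^ k := by rw [zpow_mul]; norm_cast
    rw [this, hsq]
    exact (map_zpow (Equiv.Perm.sumCongrHom α α) (u, u) k).symm
  have hll : ∀ i j, W.SameCycle (Sum.inl i) (Sum.inl j) ↔ u.SameCycle i j := by
    intro i j
    constructor
    · rintro ⟨k, hk⟩
      -- Even powers of `W` act as powers of `u` on both copies; odd powers change the copy, so they
      -- cannot join two left points.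
      rcases Int.even_or_odd' k with ⟨m, rfl | rfl⟩
      · exact ⟨m, by simpa [hz] using hk⟩
      · rw [add_comm, zpow_add, Equiv.Perm.mul_apply, hz] at hk
        simp [hl] at hk
    · rintro ⟨k, hk⟩
      exact ⟨2 * k, by simp [hz, hk]⟩
  have hlr : ∀ i j, W.SameCycle (Sum.inl i) (Sum.inr j) ↔ u.SameCycle i j := by
    intro i j
    rw [← hl, Equiv.Perm.sameCycle_apply_right, hll]
  have h1 : ∀ i, orbitOf W (Sum.inl i) = (orbitOf u i).disjSum (orbitOf u i) := by
    intro i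
    ext j
    rcases j with j | j <;> simp [mem_orbitOf, hll, hlr]
  have h2 : ∀ i, orbitOf W (Sum.inr i) = orbitOf W (Sum.inl i) := by
    intro i
    ext j
    rw [mem_orbitOf, mem_orbitOf, ← hl, Equiv.Perm.sameCycle_apply_left]
  have h3 : orbits W = (orbits u).image (fun O => O.disjSum O) := by
    ext O
    simp only [orbits, Finset.mem_image, Finset.mem_univ, true_and, Sum.exists, h1, h2, or_self,
      exists_exists_eq_and]
  have hinj : Function.Injective (fun O : Finset α => O.disjSum O) := by
    intro O O' h
    ext i
    have := congrArg (Sum.inl i ∈ ·) h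
    simpa using this
  rw [parts_partition_eq_orbits, parts_partition_eq_orbits, h3,
    Finset.image_val_of_injOn hinj.injOn, Multiset.map_map, Multiset.map_map]
  simp [two_mul]

theorem card_parts_partition_eq_one_iff [Nonempty α] (w : Equiv.Perm α) :
    w.partition.parts.card = 1 ↔ ∀ i j, w.SameCycle i j := by
  rw [parts_partition_eq_orbits, Multiset.card_map, Finset.card_val, Finset.card_eq_one]
  constructor
  · rintro ⟨O, hO⟩ i j
    have hi : orbitOf w i ∈ orbits w := Finset.mem_image_of_mem _ (Finset.mem_univ i)
    have hj : orbitOf w j ∈ orbits w := Finset.mem_image_of_mem _ (Finset.mem_univ j)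
    rw [hO, Finset.mem_singleton] at hi hj
    rw [← mem_orbitOf, hi, ← hj, mem_orbitOf]
  · intro h
    refine ⟨Finset.univ, ?_⟩
    have : orbitOf w = fun _ => Finset.univ := by
      ext i j
      simp [mem_orbitOf, h i j]
    rw [orbits, this, Finset.image_const Finset.univ_nonempty]

end Orbits

/-! ### The two halves of the tree -/

/-- The leaves of `T_(n+1)` are the leaves of its two subtrees of height `n`. -/
def leafEquiv (n : ℕ) : Fin (2 ^ n) ⊕ Fin (2 ^ n) ≃ Fin (2 ^ (n + 1)) :=
  finSumFinEquiv.trans (finCongr (by rw [pow_succ]; ring))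

theorem leafEquiv_inl_val (n : ℕ) (i : Fin (2 ^ n)) : (leafEquiv n (Sum.inl i) : ℕ) = i := rfl

theorem leafEquiv_inr_val (n : ℕ) (i : Fin (2 ^ n)) :
    (leafEquiv n (Sum.inr i) : ℕ) = 2 ^ n + i := rfl

/-- The permutation of the leaves of `T_(n+1)` that acts as `u` on the left subtree and as `v` on
the right subtree. -/
def pair {n : ℕ} (u v : Equiv.Perm (Fin (2 ^ n))) : Equiv.Perm (Fin (2 ^ (n + 1))) :=
  (leafEquiv n).permCongr (Equiv.sumCongr u v)

/-- The exchange of the two subtrees of `T_(n+1)`. -/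
def halfSwap (n : ℕ) : Equiv.Perm (Fin (2 ^ (n + 1))) :=
  (leafEquiv n).permCongr (Equiv.sumComm _ _)

section Pair

variable {n : ℕ} (u v u' v' : Equiv.Perm (Fin (2 ^ n)))

theorem pair_inl (i : Fin (2 ^ n)) :
    pair u v (leafEquiv n (Sum.inl i)) = leafEquiv n (Sum.inl (u i)) := by
  simp [pair]

theorem pair_inr (i : Fin (2 ^ n)) :
    pair u v (leafEquiv n (Sum.inr i)) = leafEquiv n (Sum.inr (v i)) := by
  simp [pair]

theorem halfSwap_inl (i : Fin (2 ^ n)) :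
    halfSwap n (leafEquiv n (Sum.inl i)) = leafEquiv n (Sum.inr i) := by
  simp [halfSwap]

theorem halfSwap_inr (i : Fin (2 ^ n)) :
    halfSwap n (leafEquiv n (Sum.inr i)) = leafEquiv n (Sum.inl i) := by
  simp [halfSwap]

theorem perm_ext_leaf {w w' : Equiv.Perm (Fin (2 ^ (n + 1)))}
    (hl : ∀ i, w (leafEquiv n (Sum.inl i)) = w' (leafEquiv n (Sum.inl i)))
    (hr : ∀ i, w (leafEquiv n (Sum.inr i)) = w' (leafEquiv n (Sum.inr i))) : w = w' := by
  refine Equiv.ext fun i => ?_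
  obtain ⟨i | i, rfl⟩ := (leafEquiv n).surjective i
  · exact hl i
  · exact hr i

theorem pair_mul : pair u v * pair u' v' = pair (u * u') (v * v') := by
  apply perm_ext_leaf <;> intro i <;> simp [pair_inl, pair_inr]

theorem pair_one : pair (1 : Equiv.Perm (Fin (2 ^ n))) 1 = 1 := by
  apply perm_ext_leaf <;> intro i <;> simp [pair_inl, pair_inr]

theorem pair_inv : (pair u v)⁻¹ = pair u⁻¹ v⁻¹ := by
  rw [inv_eq_iff_mul_eq_one, pair_mul, mul_inv_cancel, mul_inv_cancel, pair_one]

theorem halfSwap_mul_self : halfSwap n * halfSwap n = 1 := by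
  apply perm_ext_leaf <;> intro i <;> simp [halfSwap_inl, halfSwap_inr]

theorem halfSwap_inv : (halfSwap n)⁻¹ = halfSwap n :=
  inv_eq_of_mul_eq_one_left halfSwap_mul_self

theorem halfSwap_mul_pair : halfSwap n * pair u v = pair v u * halfSwap n := by
  apply perm_ext_leaf <;> intro i <;> simp [pair_inl, pair_inr, halfSwap_inl, halfSwap_inr]

theorem halfSwap_mul_pair_mul (w : Equiv.Perm (Fin (2 ^ (n + 1)))) :
    halfSwap n * (pair u v * w) = pair v u * (halfSwap n * w) := by
  rw [← mul_assoc, halfSwap_mul_pair, mul_assoc]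

theorem halfSwap_mul_halfSwap_mul (w : Equiv.Perm (Fin (2 ^ (n + 1)))) :
    halfSwap n * (halfSwap n * w) = w := by
  rw [← mul_assoc, halfSwap_mul_self, one_mul]

variable {u v u' v'}

theorem pair_inj : pair u v = pair u' v' ↔ u = u' ∧ v = v' := by
  refine ⟨fun h => ⟨?_, ?_⟩, fun h => by rw [h.1, h.2]⟩
  · refine Equiv.ext fun i => ?_
    have := congrArg (· (leafEquiv n (Sum.inl i))) h
    simpa [pair_inl] using this
  · refine Equiv.ext fun i => ?_
    have := congrArg (· (leafEquiv n (Sum.inr i))) h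
    simpa [pair_inr] using this

end Pair

/-! ### The generators in terms of the two halves -/

theorem genA_val {n i : ℕ} (h : 1 ≤ i ∧ i ≤ n) (j : Fin (2 ^ n)) :
    (genA n i j : ℕ) = if (j : ℕ) < 2 ^ (i - 1) then (j : ℕ) + 2 ^ (i - 1)
      else if (j : ℕ) < 2 ^ i then (j : ℕ) - 2 ^ (i - 1) else j := by
  rw [genA, dif_pos h, Function.Involutive.coe_toPerm, exchange]
  split_ifs <;> rfl

theorem genA_succ_self (n : ℕ) : genA (n + 1) (n + 1) = halfSwap n := by
  have h : 1 ≤ n + 1 ∧ n + 1 ≤ n + 1 := by omega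
  apply perm_ext_leaf <;> intro i <;> apply Fin.ext <;> have := i.isLt <;> rw [genA_val h]
  · rw [halfSwap_inl, leafEquiv_inr_val, leafEquiv_inl_val, Nat.add_sub_cancel, if_pos this,
      add_comm]
  · rw [halfSwap_inr, leafEquiv_inl_val, leafEquiv_inr_val, Nat.add_sub_cancel,
      if_neg (by omega), if_pos (by rw [pow_succ]; omega)]
    omega

theorem genA_succ_of_le {n i : ℕ} (hi : i ≤ n) : genA (n + 1) i = pair (genA n i) 1 := by
  by_cases h : 1 ≤ i
  · have h2 : 2 ^ i ≤ 2 ^ n := Nat.pow_le_pow_right (by norm_num) hi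
    have h3 : 2 ^ (i - 1) ≤ 2 ^ n := Nat.pow_le_pow_right (by norm_num) (by omega)
    apply perm_ext_leaf <;> intro j <;> apply Fin.ext <;> rw [genA_val ⟨h, by omega⟩]
    · rw [pair_inl, leafEquiv_inl_val, leafEquiv_inl_val, genA_val ⟨h, hi⟩]
    · rw [pair_inr, Equiv.Perm.one_apply, leafEquiv_inr_val, if_neg (by omega),
        if_neg (by omega)]
  · rw [genA, dif_neg (by omega), genA, dif_neg (by omega), pair_one]

theorem odo_succ_of_le {n i : ℕ} (hi : i ≤ n) : odo (n + 1) i = pair (odo n i) 1 := by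
  induction i with
  | zero => exact pair_one.symm
  | succ i ih =>
    rw [odo, odo, ih (by omega), genA_succ_of_le hi, pair_mul, one_mul]

theorem odo_succ_self (n : ℕ) : odo (n + 1) (n + 1) = pair (odo n n) 1 * halfSwap n := by
  rw [odo, odo_succ_of_le le_rfl, genA_succ_self]

theorem odo_succ_self_inv (n : ℕ) :
    (odo (n + 1) (n + 1))⁻¹ = halfSwap n * pair (odo n n)⁻¹ 1 := by
  rw [odo_succ_self, mul_inv_rev, pair_inv, halfSwap_inv, inv_one]

theorem odo_succ_self_mul_self (n : ℕ) :
    odo (n + 1) (n + 1) * odo (n + 1) (n + 1) = pair (odo n n) (odo n n) := by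
  rw [odo_succ_self, mul_assoc, halfSwap_mul_pair_mul, halfSwap_mul_self, mul_one, pair_mul,
    one_mul, mul_one]

theorem vElt_succ_of_le {n i : ℕ} (hi : i + 2 ≤ n) : vElt (n + 1) i = pair (vElt n i) 1 := by
  rw [vElt, odo_succ_of_le hi, sq, pair_mul, vElt, sq, one_mul]

/-- Conjugation by `x_(n+2)` moves the copy of `x_n` from the left half to the right half, while
`a_(n+1)` only exchanges the two quarters of the left half. -/
theorem mElt_add_two (n : ℕ) : mElt (n + 2) = pair (halfSwap n) (pair (odo n n) 1) := by
  rw [mElt, odo_succ_of_le (show n ≤ n + 1 by omega), odo_succ_of_le (le_refl n),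
    genA_succ_of_le (le_refl (n + 1)), genA_succ_self, odo_succ_self_inv, odo_succ_self]
  simp only [mul_assoc, halfSwap_mul_pair_mul, halfSwap_mul_halfSwap_mul, pair_mul,
    one_mul, mul_one, mul_inv_cancel]

/-- Conjugation by `x_(n+1)`. -/
theorem odo_conj_pair {n : ℕ} (u v : Equiv.Perm (Fin (2 ^ n))) :
    odo (n + 1) (n + 1) * pair u v * (odo (n + 1) (n + 1))⁻¹ =
      pair (odo n n * v * (odo n n)⁻¹) u := by
  rw [odo_succ_self_inv, odo_succ_self]
  simp only [mul_assoc, halfSwap_mul_pair_mul, halfSwap_mul_halfSwap_mul, pair_mul,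
    one_mul, mul_one]

/-! ### Tree automorphisms -/

theorem pair_mem_treeAut {n : ℕ} {u v : Equiv.Perm (Fin (2 ^ n))} (hu : u ∈ treeAut n)
    (hv : v ∈ treeAut n) : pair u v ∈ treeAut (n + 1) := by
  intro k i j
  -- Blocks of height `k ≤ n` lie inside one half; for `k > n` there is only one block.
  rcases le_or_gt k n with hk | hk
  · have hpow : 2 ^ n = 2 ^ (n - k) * 2 ^ k := by rw [← pow_add, Nat.sub_add_cancel hk]
    have hpos : 0 < 2 ^ k := by positivity
    have hlow : ∀ i : Fin (2 ^ n), (i : ℕ) / 2 ^ k < 2 ^ (n - k) := fun i =>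
      Nat.div_lt_of_lt_mul (by rw [mul_comm, ← hpow]; exact i.isLt)
    have hhigh : ∀ i : ℕ, (2 ^ n + i) / 2 ^ k = 2 ^ (n - k) + i / 2 ^ k := fun i => by
      rw [hpow, add_comm, Nat.add_mul_div_right _ _ hpos, add_comm]
    obtain ⟨i | i, rfl⟩ := (leafEquiv n).surjective i <;>
    obtain ⟨j | j, rfl⟩ := (leafEquiv n).surjective j <;>
    simp only [pair_inl, pair_inr, leafEquiv_inl_val, leafEquiv_inr_val, hhigh]
    · exact hu k i j
    · exact iff_of_false (Nat.ne_of_lt (Nat.lt_add_right _ (hlow _)))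
        (Nat.ne_of_lt (Nat.lt_add_right _ (hlow _)))
    · exact iff_of_false (Nat.ne_of_gt (Nat.lt_add_right _ (hlow _)))
        (Nat.ne_of_gt (Nat.lt_add_right _ (hlow _)))
    · rw [Nat.add_left_cancel_iff, Nat.add_left_cancel_iff]
      exact hv k i j
  · have hz : ∀ i : Fin (2 ^ (n + 1)), (i : ℕ) / 2 ^ k = 0 := fun i =>
      Nat.div_eq_of_lt (i.isLt.trans_le (Nat.pow_le_pow_right (by norm_num) hk))
    simp only [hz]

theorem halfSwap_mem_treeAut (n : ℕ) : halfSwap n ∈ treeAut (n + 1) := by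
  intro k i j
  rcases le_or_gt k n with hk | hk
  · have hpow : 2 ^ n = 2 ^ (n - k) * 2 ^ k := by rw [← pow_add, Nat.sub_add_cancel hk]
    have hpos : 0 < 2 ^ k := by positivity
    have hlow : ∀ i : Fin (2 ^ n), (i : ℕ) / 2 ^ k < 2 ^ (n - k) := fun i =>
      Nat.div_lt_of_lt_mul (by rw [mul_comm, ← hpow]; exact i.isLt)
    have hhigh : ∀ i : ℕ, (2 ^ n + i) / 2 ^ k = 2 ^ (n - k) + i / 2 ^ k := fun i => by
      rw [hpow, add_comm, Nat.add_mul_div_right _ _ hpos, add_comm]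
    obtain ⟨i | i, rfl⟩ := (leafEquiv n).surjective i <;>
    obtain ⟨j | j, rfl⟩ := (leafEquiv n).surjective j <;>
    simp only [halfSwap_inl, halfSwap_inr, leafEquiv_inl_val, leafEquiv_inr_val, hhigh]
    · rw [Nat.add_left_cancel_iff]
    · exact iff_of_false (Nat.ne_of_gt (Nat.lt_add_right _ (hlow _)))
        (Nat.ne_of_lt (Nat.lt_add_right _ (hlow _)))
    · exact iff_of_false (Nat.ne_of_lt (Nat.lt_add_right _ (hlow _)))
        (Nat.ne_of_gt (Nat.lt_add_right _ (hlow _)))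
    · rw [Nat.add_left_cancel_iff]
  · have hz : ∀ i : Fin (2 ^ (n + 1)), (i : ℕ) / 2 ^ k = 0 := fun i =>
      Nat.div_eq_of_lt (i.isLt.trans_le (Nat.pow_le_pow_right (by norm_num) hk))
    simp only [hz]

theorem genA_mem_treeAut (n i : ℕ) : genA n i ∈ treeAut n := by
  induction n with
  | zero => rw [genA, dif_neg (by omega)]; exact one_mem _
  | succ n ih =>
    rcases le_or_gt i n with h | h
    · rw [genA_succ_of_le h]
      exact pair_mem_treeAut ih (one_mem _)
    · rcases eq_or_lt_of_le (Nat.succ_le_of_lt h) with rfl | h'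
      · rw [Nat.succ_eq_add_one, genA_succ_self]
        exact halfSwap_mem_treeAut n
      · rw [genA, dif_neg (by omega)]
        exact one_mem _

theorem odo_mem_treeAut (n i : ℕ) : odo n i ∈ treeAut n := by
  induction i with
  | zero => exact one_mem _
  | succ i ih => exact mul_mem ih (genA_mem_treeAut n _)

theorem mElt_mem_treeAut (n : ℕ) : mElt n ∈ treeAut n := by
  match n with
  | 0 => exact one_mem _
  | 1 => exact one_mem _
  | n + 2 =>
    exact mul_mem (genA_mem_treeAut _ _)
      (mul_mem (mul_mem (odo_mem_treeAut _ _) (odo_mem_treeAut _ _))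
        (inv_mem (odo_mem_treeAut _ _)))

theorem grpM_le_treeAut (n : ℕ) : grpM n ≤ treeAut n := by
  rw [grpM, Subgroup.closure_le]
  rintro w ((rfl | rfl) | ⟨i, -, rfl⟩)
  · exact odo_mem_treeAut _ _
  · exact mElt_mem_treeAut _
  · exact pow_mem (odo_mem_treeAut _ _) 2

theorem grpN_le_grpM (n : ℕ) : grpN n ≤ grpM n := by
  rintro _ ⟨w, -, rfl⟩
  exact w.2

theorem grpM2_le_treeAut (n : ℕ) : grpM2 n ≤ treeAut n := by
  rw [grpM2, Subgroup.closure_le]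
  rintro w (rfl | h)
  · exact mul_mem (odo_mem_treeAut _ _) (mElt_mem_treeAut _)
  · exact grpM_le_treeAut n (grpN_le_grpM n h.1)

/-! ### Cycle types -/

theorem cyc_pair {n : ℕ} (u v : Equiv.Perm (Fin (2 ^ n))) :
    cyc (pair u v) = cyc u + cyc v := by
  rw [cyc, pair, parts_partition_permCongr, parts_partition_sumCongr, cyc, cyc]

/-- The square acts on the left half as `u * v`. Conjugating by an element supported on the right
half gathers both factors on the left, which reduces to the case of a trivial right entry. -/
theorem cyc_pair_mul_halfSwap {n : ℕ} (u v : Equiv.Perm (Fin (2 ^ n))) :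
    cyc (pair u v * halfSwap n) = (cyc (u * v)).map (2 * ·) := by
  have hconj : IsConj (pair u v * halfSwap n) (pair (u * v) 1 * halfSwap n) := by
    refine isConj_iff.2 ⟨pair 1 v⁻¹, ?_⟩
    rw [pair_inv, ← mul_assoc, pair_mul, mul_assoc, halfSwap_mul_pair, ← mul_assoc, pair_mul]
    simp
  rw [cyc, Equiv.Perm.partition_eq_of_isConj.1 hconj, pair, halfSwap, ← Equiv.permCongr_mul,
    parts_partition_permCongr, parts_partition_sumCongr_one_mul_sumComm, cyc]

theorem cyc_zero (w : Equiv.Perm (Fin (2 ^ 0))) : cyc w = {1} := by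
  have : w = 1 := Equiv.ext fun i => Subsingleton.elim (α := Fin 1) _ _
  subst this
  simp [cyc, Equiv.Perm.parts_partition]

theorem card_cyc_pos {n : ℕ} (w : Equiv.Perm (Fin (2 ^ n))) : 0 < (cyc w).card := by
  rw [Multiset.card_pos]
  intro h
  have := w.partition.parts_sum
  rw [cyc] at h
  rw [h, Multiset.sum_zero, Fintype.card_fin] at this
  exact (Nat.two_pow_pos n).ne this

theorem isOdometer_iff {n : ℕ} (w : Equiv.Perm (Fin (2 ^ n))) :
    IsOdometer n w ↔ (cyc w).card = 1 :=
  (card_parts_partition_eq_one_iff w).symm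

/-! ### Adjoining to a subgroup a square root of one of its elements -/

section AdjoinRoot

variable {G : Type*} [Group G]

theorem inv_conj_mem {K : Subgroup G} {g : G} (hg : ∀ k ∈ K, g * k * g⁻¹ ∈ K) (hg2 : g * g ∈ K)
    {k : G} (hk : k ∈ K) : g⁻¹ * k * g ∈ K := by
  have : g⁻¹ * k * g = (g * g)⁻¹ * (g * k * g⁻¹) * (g * g) := by group
  rw [this]
  exact mul_mem (mul_mem (inv_mem hg2) (hg k hk)) hg2

theorem mem_normalizer_of_sq_mem {K : Subgroup G} {g : G} (hg : ∀ k ∈ K, g * k * g⁻¹ ∈ K)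
    (hg2 : g * g ∈ K) : g ∈ Subgroup.normalizer (K : Set G) := by
  rw [Subgroup.mem_normalizer_iff]
  refine fun k => ⟨hg k, fun h => ?_⟩
  have := inv_conj_mem hg hg2 h
  rwa [show g⁻¹ * (g * k * g⁻¹) * g = k by group] at this

/-- The subgroup `K ∪ gK`, where `g` normalizes `K` and `g² ∈ K`. -/
def adjoinRoot (K : Subgroup G) (g : G) (hg : ∀ k ∈ K, g * k * g⁻¹ ∈ K) (hg2 : g * g ∈ K) :
    Subgroup G where
  carrier := {w | w ∈ K ∨ g⁻¹ * w ∈ K}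
  one_mem' := Or.inl (one_mem K)
  mul_mem' := by
    rintro a b (ha | ha) (hb | hb)
    · exact Or.inl (mul_mem ha hb)
    · refine Or.inr ?_
      rw [show g⁻¹ * (a * b) = (g⁻¹ * a * g) * (g⁻¹ * b) by group]
      exact mul_mem (inv_conj_mem hg hg2 ha) hb
    · refine Or.inr ?_
      rw [← mul_assoc]
      exact mul_mem ha hb
    · refine Or.inl ?_
      rw [show a * b = (g * (g⁻¹ * a) * g⁻¹) * (g * g) * (g⁻¹ * b) by group]
      exact mul_mem (mul_mem (hg _ ha) hg2) hb
  inv_mem' := by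
    rintro a (ha | ha)
    · exact Or.inl (inv_mem ha)
    · refine Or.inr ?_
      rw [show g⁻¹ * a⁻¹ = (g * g)⁻¹ * (g * (g⁻¹ * a)⁻¹ * g⁻¹) by group]
      exact mul_mem (inv_mem hg2) (hg _ (inv_mem ha))

end AdjoinRoot

/-! ### The groups `K_n` -/

/-- The pairs `(u, v)` with both entries in `K`, or both entries in the coset `gK`, where `g`
normalizes `K` and `g² ∈ K`. -/
def pairSubgroup {n : ℕ} (K : Subgroup (Equiv.Perm (Fin (2 ^ n)))) (g : Equiv.Perm (Fin (2 ^ n)))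
    (hg : ∀ k ∈ K, g * k * g⁻¹ ∈ K) (hg2 : g * g ∈ K) :
    Subgroup (Equiv.Perm (Fin (2 ^ (n + 1)))) where
  carrier := {w | ∃ u v, w = pair u v ∧ ((u ∈ K ∧ v ∈ K) ∨ (g⁻¹ * u ∈ K ∧ g⁻¹ * v ∈ K))}
  one_mem' := ⟨1, 1, pair_one.symm, Or.inl ⟨one_mem K, one_mem K⟩⟩
  mul_mem' := by
    have h1 : ∀ {a b}, a ∈ K → g⁻¹ * b ∈ K → g⁻¹ * (a * b) ∈ K := by
      intro a b ha hb
      rw [show g⁻¹ * (a * b) = (g⁻¹ * a * g) * (g⁻¹ * b) by group]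
      exact mul_mem (inv_conj_mem hg hg2 ha) hb
    have h2 : ∀ {a b}, g⁻¹ * a ∈ K → b ∈ K → g⁻¹ * (a * b) ∈ K := by
      intro a b ha hb
      rw [← mul_assoc]
      exact mul_mem ha hb
    have h3 : ∀ {a b}, g⁻¹ * a ∈ K → g⁻¹ * b ∈ K → a * b ∈ K := by
      intro a b ha hb
      rw [show a * b = (g * (g⁻¹ * a) * g⁻¹) * (g * g) * (g⁻¹ * b) by group]
      exact mul_mem (mul_mem (hg _ ha) hg2) hb
    rintro _ _ ⟨u, v, rfl, ⟨hu, hv⟩ | ⟨hu, hv⟩⟩ ⟨u', v', rfl, ⟨hu', hv'⟩ | ⟨hu', hv'⟩⟩ <;>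
    refine ⟨u * u', v * v', pair_mul _ _ _ _, ?_⟩
    · exact Or.inl ⟨mul_mem hu hu', mul_mem hv hv'⟩
    · exact Or.inr ⟨h1 hu hu', h1 hv hv'⟩
    · exact Or.inr ⟨h2 hu hu', h2 hv hv'⟩
    · exact Or.inl ⟨h3 hu hu', h3 hv hv'⟩
  inv_mem' := by
    have h1 : ∀ {a}, g⁻¹ * a ∈ K → g⁻¹ * a⁻¹ ∈ K := by
      intro a ha
      rw [show g⁻¹ * a⁻¹ = (g * g)⁻¹ * (g * (g⁻¹ * a)⁻¹ * g⁻¹) by group]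
      exact mul_mem (inv_mem hg2) (hg _ (inv_mem ha))
    rintro _ ⟨u, v, rfl, ⟨hu, hv⟩ | ⟨hu, hv⟩⟩ <;> refine ⟨u⁻¹, v⁻¹, pair_inv _ _, ?_⟩
    · exact Or.inl ⟨inv_mem hu, inv_mem hv⟩
    · exact Or.inr ⟨h1 hu, h1 hv⟩

/-- A subgroup of `W_n` normalized by `x_n` and containing `x_n²`. -/
structure OdoSubgroup (n : ℕ) where
  /-- The underlying subgroup. -/
  toSubgroup : Subgroup (Equiv.Perm (Fin (2 ^ n)))
  conj_mem : ∀ k ∈ toSubgroup, odo n n * k * (odo n n)⁻¹ ∈ toSubgroup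
  sq_mem : odo n n * odo n n ∈ toSubgroup

/-- The groups `K_n`: `K_0` is trivial, and `K_(n+1)` consists of the pairs with both entries in
`K_n` and the pairs with both entries in `x_n K_n`. -/
def odoK : (n : ℕ) → OdoSubgroup n
  | 0 => ⟨⊥, fun k hk => by rw [Subgroup.mem_bot.1 hk]; simp, by simp [odo]⟩
  | n + 1 => ⟨pairSubgroup (odoK n).1 (odo n n) (odoK n).2 (odoK n).3, by
      rintro _ ⟨u, v, rfl, ⟨hu, hv⟩ | ⟨hu, hv⟩⟩ <;> rw [odo_conj_pair]
      · exact ⟨_, _, rfl, Or.inl ⟨(odoK n).2 v hv, hu⟩⟩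
      · refine ⟨_, _, rfl, Or.inr ⟨?_, hu⟩⟩
        rw [show (odo n n)⁻¹ * (odo n n * v * (odo n n)⁻¹) =
          odo n n * ((odo n n)⁻¹ * v) * (odo n n)⁻¹ by group]
        exact (odoK n).2 _ hv, by
      rw [odo_succ_self_mul_self]
      exact ⟨_, _, rfl, Or.inr ⟨by simp, by simp⟩⟩⟩

/-- The underlying subgroup of `K_n`. -/
def grpK (n : ℕ) : Subgroup (Equiv.Perm (Fin (2 ^ n))) := (odoK n).1

theorem odo_conj_mem {n : ℕ} {k : Equiv.Perm (Fin (2 ^ n))} (hk : k ∈ grpK n) :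
    odo n n * k * (odo n n)⁻¹ ∈ grpK n := (odoK n).2 k hk

theorem odo_sq_mem (n : ℕ) : odo n n * odo n n ∈ grpK n := (odoK n).3

theorem mem_grpK_zero {w : Equiv.Perm (Fin (2 ^ 0))} : w ∈ grpK 0 ↔ w = 1 := Subgroup.mem_bot

theorem mem_grpK_succ {n : ℕ} {w : Equiv.Perm (Fin (2 ^ (n + 1)))} :
    w ∈ grpK (n + 1) ↔ ∃ u v, w = pair u v ∧
      ((u ∈ grpK n ∧ v ∈ grpK n) ∨ ((odo n n)⁻¹ * u ∈ grpK n ∧ (odo n n)⁻¹ * v ∈ grpK n)) :=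
  Iff.rfl

theorem pair_mem_grpK {n : ℕ} {u v : Equiv.Perm (Fin (2 ^ n))} (hu : u ∈ grpK n)
    (hv : v ∈ grpK n) : pair u v ∈ grpK (n + 1) := ⟨u, v, rfl, Or.inl ⟨hu, hv⟩⟩

theorem pair_mem_grpK_of_odo {n : ℕ} {u v : Equiv.Perm (Fin (2 ^ n))}
    (hu : (odo n n)⁻¹ * u ∈ grpK n) (hv : (odo n n)⁻¹ * v ∈ grpK n) :
    pair u v ∈ grpK (n + 1) := ⟨u, v, rfl, Or.inr ⟨hu, hv⟩⟩

theorem odo_inv_mul_inv_mem (n : ℕ) : (odo n n)⁻¹ * (odo n n)⁻¹ ∈ grpK n := by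
  rw [← mul_inv_rev]
  exact inv_mem (odo_sq_mem n)

theorem pair_odo_odo_inv_mem (n : ℕ) : pair (odo n n) (odo n n)⁻¹ ∈ grpK (n + 1) :=
  pair_mem_grpK_of_odo (by simp) (odo_inv_mul_inv_mem n)

theorem pair_odo_inv_odo_mem (n : ℕ) : pair (odo n n)⁻¹ (odo n n) ∈ grpK (n + 1) :=
  pair_mem_grpK_of_odo (odo_inv_mul_inv_mem n) (by simp)

theorem pair_odo_odo_mem (n : ℕ) : pair (odo n n) (odo n n) ∈ grpK (n + 1) :=
  pair_mem_grpK_of_odo (by simp) (by simp)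

theorem halfSwap_conj_mem {n : ℕ} {k : Equiv.Perm (Fin (2 ^ (n + 1)))} (hk : k ∈ grpK (n + 1)) :
    halfSwap n * k * halfSwap n ∈ grpK (n + 1) := by
  obtain ⟨u, v, rfl, h⟩ := mem_grpK_succ.1 hk
  rw [halfSwap_mul_pair, mul_assoc, halfSwap_mul_self, mul_one]
  exact ⟨v, u, rfl, h.imp And.symm And.symm⟩

/-- `x⁻¹ · (s x s) ∈ K_(n+1)` for `x = x_(n+1)`, where `s` exchanges the two subtrees. -/
theorem odo_inv_mul_halfSwap_conj_odo_mem (n : ℕ) :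
    (odo (n + 1) (n + 1))⁻¹ * (halfSwap n * odo (n + 1) (n + 1) * halfSwap n) ∈
      grpK (n + 1) := by
  rw [odo_succ_self_inv, odo_succ_self]
  simp only [mul_assoc, halfSwap_mul_pair_mul, pair_mul, halfSwap_mul_self, one_mul, mul_one]
  exact pair_odo_odo_inv_mem n

theorem halfSwap_conj_odo_mul_mem {n : ℕ} {k : Equiv.Perm (Fin (2 ^ (n + 1)))}
    (hk : (odo (n + 1) (n + 1))⁻¹ * k ∈ grpK (n + 1)) :
    (odo (n + 1) (n + 1))⁻¹ * (halfSwap n * k * halfSwap n) ∈ grpK (n + 1) := by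
  have := mul_mem (odo_inv_mul_halfSwap_conj_odo_mem n) (halfSwap_conj_mem hk)
  simpa only [mul_assoc, halfSwap_mul_halfSwap_mul, mul_inv_cancel_left] using this

/-! ### Cycle types in `K_n` and `x_n K_n` -/

/-- Multiplying `pair u v` by `x_(n+1)` gives a half-exchanging element whose type is the double of
that of `x_n v u`. Since `u` and `v` lie in the same coset of `K_n` and `x_n² ∈ K_n`, the product `v
u` lies in `K_n`, and induction applies. -/
theorem cyc_odo_mul {n : ℕ} {k : Equiv.Perm (Fin (2 ^ n))} (hk : k ∈ grpK n) :
    cyc (odo n n * k) = {2 ^ n} := by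
  induction n with
  | zero => exact cyc_zero _
  | succ n ih =>
    have key : ∀ u v, v * u ∈ grpK n →
        cyc (odo (n + 1) (n + 1) * pair u v) = {2 ^ (n + 1)} := by
      intro u v h
      rw [odo_succ_self, mul_assoc, halfSwap_mul_pair, ← mul_assoc, pair_mul,
        cyc_pair_mul_halfSwap, one_mul, mul_assoc, ih h, Multiset.map_singleton, pow_succ']
    obtain ⟨u, v, rfl, ⟨hu, hv⟩ | ⟨hu, hv⟩⟩ := mem_grpK_succ.1 hk
    · exact key u v (mul_mem hv hu)
    · refine key u v ?_
      rw [show v * u = (odo n n * ((odo n n)⁻¹ * v) * (odo n n)⁻¹) * (odo n n * odo n n) *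
        ((odo n n)⁻¹ * u) by group]
      exact mul_mem (mul_mem (odo_conj_mem hv) (odo_sq_mem n)) hu

theorem cyc_of_odo_inv_mul_mem {n : ℕ} {w : Equiv.Perm (Fin (2 ^ n))}
    (hw : (odo n n)⁻¹ * w ∈ grpK n) : cyc w = {2 ^ n} := by
  simpa using cyc_odo_mul hw

theorem two_le_card_cyc {n : ℕ} {k : Equiv.Perm (Fin (2 ^ (n + 1)))} (hk : k ∈ grpK (n + 1)) :
    2 ≤ (cyc k).card := by
  obtain ⟨u, v, rfl, -⟩ := mem_grpK_succ.1 hk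
  rw [cyc_pair, Multiset.card_add]
  have := card_cyc_pos u
  have := card_cyc_pos v
  omega

theorem odo_notMem_grpK (n : ℕ) : odo (n + 1) (n + 1) ∉ grpK (n + 1) := by
  intro h
  have h1 := two_le_card_cyc h
  have h2 := cyc_of_odo_inv_mul_mem (w := odo (n + 1) (n + 1)) (by simp)
  rw [h2, Multiset.card_singleton] at h1
  omega

/-! ### The element `m_n` -/

theorem odo_conj_pair_odo_one (n : ℕ) :
    odo (n + 1) (n + 1) * pair (odo n n) 1 * (odo (n + 1) (n + 1))⁻¹ = pair 1 (odo n n) := by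
  rw [odo_conj_pair, mul_one, mul_inv_cancel]

theorem pair_odo_one_conj_mem {n : ℕ} {k : Equiv.Perm (Fin (2 ^ (n + 1)))}
    (hk : k ∈ grpK (n + 1)) :
    pair (odo n n) 1 * k * (pair (odo n n) 1)⁻¹ ∈ grpK (n + 1) := by
  obtain ⟨u, v, rfl, ⟨hu, hv⟩ | ⟨hu, hv⟩⟩ := mem_grpK_succ.1 hk <;>
  rw [pair_inv, pair_mul, pair_mul, inv_one, one_mul, mul_one]
  · exact pair_mem_grpK (odo_conj_mem hu) hv
  · refine pair_mem_grpK_of_odo ?_ hv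
    rw [show (odo n n)⁻¹ * (odo n n * u * (odo n n)⁻¹) =
      odo n n * ((odo n n)⁻¹ * u) * (odo n n)⁻¹ by group]
    exact odo_conj_mem hu

/-- With `x = x_(n+1)` and `p = pair (odo n n) 1`, conjugation by `p` preserves `K_(n+1)`; it
preserves the coset `x K_(n+1)` because `x⁻¹ p x p⁻¹` lies in `K_(n+1)`. -/
theorem pair_odo_one_conj_odo_mul_mem {n : ℕ} {k : Equiv.Perm (Fin (2 ^ (n + 1)))}
    (hk : (odo (n + 1) (n + 1))⁻¹ * k ∈ grpK (n + 1)) :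
    (odo (n + 1) (n + 1))⁻¹ * (pair (odo n n) 1 * k * (pair (odo n n) 1)⁻¹) ∈ grpK (n + 1) := by
  have h : (odo (n + 1) (n + 1))⁻¹ * pair (odo n n) 1 * odo (n + 1) (n + 1) *
      (pair (odo n n) 1)⁻¹ ∈ grpK (n + 1) := by
    rw [odo_succ_self_inv, odo_succ_self, pair_inv]
    simp only [mul_assoc, halfSwap_mul_pair_mul, pair_mul, halfSwap_mul_self, one_mul, mul_one,
      halfSwap_mul_pair, inv_one]
    simpa using pair_odo_inv_odo_mem n
  have := mul_mem h (pair_odo_one_conj_mem hk)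
  rwa [show ∀ x p : Equiv.Perm (Fin (2 ^ (n + 1))), x⁻¹ * p * x * p⁻¹ * (p * (x⁻¹ * k) * p⁻¹) =
    x⁻¹ * (p * k * p⁻¹) by intros; group] at this

theorem mElt_conj_mem {n : ℕ} {k : Equiv.Perm (Fin (2 ^ (n + 2)))} (hk : k ∈ grpK (n + 2)) :
    mElt (n + 2) * k * (mElt (n + 2))⁻¹ ∈ grpK (n + 2) := by
  obtain ⟨u, v, rfl, ⟨hu, hv⟩ | ⟨hu, hv⟩⟩ := mem_grpK_succ.1 hk <;>
  rw [mElt_add_two, pair_inv, pair_mul, pair_mul, halfSwap_inv]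
  · exact pair_mem_grpK (halfSwap_conj_mem hu) (pair_odo_one_conj_mem hv)
  · exact pair_mem_grpK_of_odo (halfSwap_conj_odo_mul_mem hu) (pair_odo_one_conj_odo_mul_mem hv)

theorem mElt_sq_mem (n : ℕ) : mElt (n + 2) * mElt (n + 2) ∈ grpK (n + 2) := by
  rw [mElt_add_two, pair_mul, halfSwap_mul_self, pair_mul, one_mul]
  exact pair_mem_grpK (one_mem _) (pair_mem_grpK (odo_sq_mem n) (one_mem _))

/-- The commutator of `x_n` and `m_n` is a pair of elements of `x_(n-1) K_(n-1)`. -/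
theorem exists_commutator_eq_pair (n : ℕ) :
    ∃ p q, odo (n + 2) (n + 2) * mElt (n + 2) * (odo (n + 2) (n + 2))⁻¹ * (mElt (n + 2))⁻¹ =
      pair p q ∧ (odo (n + 1) (n + 1))⁻¹ * p ∈ grpK (n + 1) ∧
        (odo (n + 1) (n + 1))⁻¹ * q ∈ grpK (n + 1) := by
  refine ⟨_, _, by rw [mElt_add_two, odo_conj_pair, pair_inv, pair_mul, odo_conj_pair_odo_one],
    ?_, ?_⟩
  · rw [odo_succ_self_inv, halfSwap_inv]
    simp only [mul_assoc, halfSwap_mul_pair_mul, pair_mul, halfSwap_mul_self, one_mul, mul_one]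
    exact pair_odo_odo_inv_mem n
  · rw [odo_succ_self_inv, pair_inv]
    simp only [mul_assoc, halfSwap_mul_pair_mul, pair_mul, halfSwap_mul_self, one_mul, mul_one,
      halfSwap_mul_pair, inv_one]
    exact pair_mem_grpK_of_odo (odo_inv_mul_inv_mem n) (odo_inv_mul_inv_mem n)

theorem commutator_mem (n : ℕ) :
    odo (n + 2) (n + 2) * mElt (n + 2) * (odo (n + 2) (n + 2))⁻¹ * (mElt (n + 2))⁻¹ ∈
      grpK (n + 2) := by
  obtain ⟨p, q, h, hp, hq⟩ := exists_commutator_eq_pair n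
  rw [h]
  exact pair_mem_grpK_of_odo hp hq

theorem vElt_mem_grpK {n i : ℕ} (hi : i + 2 ≤ n) : vElt n i ∈ grpK n := by
  induction n with
  | zero => omega
  | succ n ih =>
    rcases eq_or_lt_of_le hi with h | h
    · rw [vElt, h, sq]
      exact odo_sq_mem _
    · rw [vElt_succ_of_le (by omega)]
      exact pair_mem_grpK (ih (by omega)) (one_mem _)

/-! ### The group `N_n` and its odometer part -/

theorem mem_grpN_of_mem_grpH {n : ℕ} {w : Equiv.Perm (Fin (2 ^ n))} (hw : w ∈ grpH n) :
    w ∈ grpN n := by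
  have hM : w ∈ grpM n :=
    Subgroup.closure_mono (Set.union_subset_union_left _ (by simp)) hw
  exact ⟨⟨w, hM⟩, Subgroup.subset_normalClosure (by simpa [Subgroup.mem_subgroupOf] using hw), rfl⟩

theorem conj_mem_grpN {n : ℕ} {g w : Equiv.Perm (Fin (2 ^ n))} (hg : g ∈ grpM n)
    (hw : w ∈ grpN n) : g * w * g⁻¹ ∈ grpN n := by
  obtain ⟨w, hw, rfl⟩ := hw
  exact ⟨⟨g, hg⟩ * w * ⟨g, hg⟩⁻¹, Subgroup.normalClosure_normal.conj_mem w hw _, rfl⟩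

theorem odo_mem_grpM (n : ℕ) : odo n n ∈ grpM n := Subgroup.subset_closure (by simp)

/-- Conjugation by `x_(n+1)` carries the left copy of `K_n` to the right one, giving `K_n × K_n`.
This has index at most two in `K_(n+1)`, so one pair from the other coset suffices. -/
theorem grpK_succ_le {n : ℕ} {A : Subgroup (Equiv.Perm (Fin (2 ^ (n + 1))))}
    (hA : ∀ w ∈ A, odo (n + 1) (n + 1) * w * (odo (n + 1) (n + 1))⁻¹ ∈ A)
    (hl : ∀ u ∈ grpK n, pair u 1 ∈ A) {p q : Equiv.Perm (Fin (2 ^ n))} (hpq : pair p q ∈ A)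
    (hp : (odo n n)⁻¹ * p ∈ grpK n) (hq : (odo n n)⁻¹ * q ∈ grpK n) : grpK (n + 1) ≤ A := by
  have hall : ∀ u ∈ grpK n, ∀ v ∈ grpK n, pair u v ∈ A := by
    intro u hu v hv
    have h1 := hA _ (hl v hv)
    rw [odo_conj_pair, mul_one, mul_inv_cancel] at h1
    have h2 := mul_mem (hl u hu) h1
    rwa [pair_mul, mul_one, one_mul] at h2
  intro w hw
  obtain ⟨u, v, rfl, ⟨hu, hv⟩ | ⟨hu, hv⟩⟩ := mem_grpK_succ.1 hw
  · exact hall u hu v hv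
  · have h := mul_mem hpq (hall _ (mul_mem (inv_mem hp) hu) _ (mul_mem (inv_mem hq) hv))
    rw [pair_mul] at h
    simpa using h

/-- Restricting to the left subtree a subgroup normalized by `x_(n+1)` gives one normalized
by `x_n`. -/
theorem odo_conj_mem_of_pair_one {n : ℕ} {A : Subgroup (Equiv.Perm (Fin (2 ^ (n + 1))))}
    (hA : ∀ w ∈ A, odo (n + 1) (n + 1) * w * (odo (n + 1) (n + 1))⁻¹ ∈ A)
    {u : Equiv.Perm (Fin (2 ^ n))} (hu : pair u 1 ∈ A) :
    pair (odo n n * u * (odo n n)⁻¹) 1 ∈ A := by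
  have := hA _ (hA _ hu)
  rwa [odo_conj_pair, odo_conj_pair, mul_one, mul_inv_cancel] at this

/-- The subgroup of the elements of `A` supported on the left subtree. -/
def leftPart {n : ℕ} (A : Subgroup (Equiv.Perm (Fin (2 ^ (n + 1))))) :
    Subgroup (Equiv.Perm (Fin (2 ^ n))) where
  carrier := {u | pair u 1 ∈ A}
  one_mem' := by
    change pair 1 1 ∈ A
    rw [pair_one]
    exact one_mem A
  mul_mem' := by
    intro u v hu hv
    have := A.mul_mem hu hv
    rwa [pair_mul, one_mul] at this
  inv_mem' := by
    intro u hu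
    have := A.inv_mem hu
    rwa [pair_inv, inv_one] at this

theorem grpK_le_of_vElt_mem {n : ℕ} {A : Subgroup (Equiv.Perm (Fin (2 ^ n)))}
    (hA : ∀ w ∈ A, odo n n * w * (odo n n)⁻¹ ∈ A) (hv : ∀ i, i + 2 ≤ n → vElt n i ∈ A) :
    grpK n ≤ A := by
  induction n with
  | zero =>
    intro w hw
    rw [mem_grpK_zero.1 hw]
    exact one_mem A
  | succ n ih =>
    have hl : grpK n ≤ leftPart A := by
      refine ih (A := leftPart A) (fun w hw => odo_conj_mem_of_pair_one hA hw) fun i hi => ?_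
      have := hv i (by omega)
      rwa [vElt_succ_of_le hi] at this
    refine grpK_succ_le hA (fun u hu => hl hu) (p := odo n n) (q := odo n n) ?_
      (by simp) (by simp)
    -- The pair `(x_n, x_n)` is `x_(n+1)²`: trivial when `n = 0`, and otherwise the top element
    -- `v_(n-1)`.
    rcases n with _ | n
    · rw [odo, pair_one]
      exact one_mem A
    · have := hv n le_rfl
      rwa [vElt, sq, odo_succ_self_mul_self] at this

/-- The available `v_i` all live on the left half and generate `K_(n+1)` there under conjugation.
The top one, `v_n`, is not among the generators; the commutator of `x_(n+2)` and `m_(n+2)` supplies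
the missing pair of odd entries. -/
theorem grpK_le_grpN (n : ℕ) : grpK (n + 2) ≤ grpN (n + 2) := by
  have hA : ∀ w ∈ grpN (n + 2), odo (n + 2) (n + 2) * w * (odo (n + 2) (n + 2))⁻¹ ∈
      grpN (n + 2) := fun w hw => conj_mem_grpN (odo_mem_grpM _) hw
  have hm : mElt (n + 2) ∈ grpN (n + 2) :=
    mem_grpN_of_mem_grpH (Subgroup.subset_closure (by simp))
  have hl : grpK (n + 1) ≤ leftPart (grpN (n + 2)) := by
    refine grpK_le_of_vElt_mem (fun w hw => odo_conj_mem_of_pair_one hA hw) fun i hi => ?_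
    change pair (vElt (n + 1) i) 1 ∈ grpN (n + 2)
    rw [← vElt_succ_of_le hi]
    exact mem_grpN_of_mem_grpH (Subgroup.subset_closure (Or.inr ⟨i, by omega, rfl⟩))
  obtain ⟨p, q, h, hp, hq⟩ := exists_commutator_eq_pair n
  exact grpK_succ_le hA (fun u hu => hl hu) (h ▸ mul_mem (hA _ hm) (inv_mem hm)) hp hq

/-- The set `K ∪ mK` is a group, as `m` normalizes `K` and `m² ∈ K`. It is normalized by `x` because
the commutator of `x` and `m` lies in `K`, so it contains the normal closure. -/
theorem mem_or_of_mem_grpN {n : ℕ} {w : Equiv.Perm (Fin (2 ^ (n + 2)))} (hw : w ∈ grpN (n + 2)) :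
    w ∈ grpK (n + 2) ∨ (mElt (n + 2))⁻¹ * w ∈ grpK (n + 2) := by
  set B := adjoinRoot (grpK (n + 2)) (mElt (n + 2)) (fun k hk => mElt_conj_mem hk)
    (mElt_sq_mem n) with hB
  have hmB : mElt (n + 2) ∈ B := Or.inr (by simp)
  have hKB : grpK (n + 2) ≤ B := fun k hk => Or.inl hk
  have hvB : ∀ i, i + 3 ≤ n + 2 → vElt (n + 2) i ∈ B := fun i hi =>
    hKB (vElt_mem_grpK (by omega))
  have hnorm : grpM (n + 2) ≤ Subgroup.normalizer (B : Set (Equiv.Perm (Fin (2 ^ (n + 2))))) := by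
    rw [grpM, Subgroup.closure_le]
    rintro w ((rfl | rfl) | ⟨i, hi, rfl⟩)
    · refine mem_normalizer_of_sq_mem (fun k hk => ?_) (hKB (odo_sq_mem _))
      rcases hk with hk | hk
      · exact hKB (odo_conj_mem hk)
      · have h := mul_mem (mul_mem (hKB (commutator_mem n)) hmB) (hKB (odo_conj_mem hk))
        rwa [show ∀ x m : Equiv.Perm (Fin (2 ^ (n + 2))),
          x * m * x⁻¹ * m⁻¹ * m * (x * (m⁻¹ * k) * x⁻¹) = x * k * x⁻¹ by intros; group] at h
    · exact Subgroup.le_normalizer hmB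
    · exact Subgroup.le_normalizer (hvB i hi)
  have hnormal : (B.subgroupOf (grpM (n + 2))).Normal :=
    Subgroup.normal_subgroupOf_of_le_normalizer hnorm
  have hH : grpH (n + 2) ≤ B := by
    rw [grpH, Subgroup.closure_le]
    rintro w (rfl | ⟨i, hi, rfl⟩)
    · exact hmB
    · exact hvB i hi
  obtain ⟨w, hw, rfl⟩ := hw
  have hle : Subgroup.normalClosure (((grpH (n + 2)).subgroupOf (grpM (n + 2)) :
      Subgroup (grpM (n + 2))) : Set (grpM (n + 2))) ≤ B.subgroupOf (grpM (n + 2)) :=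
    Subgroup.normalClosure_le_normal fun x hx => hH hx
  exact hle hw

/-! ### The group `M_n(2)` -/

/-- `x_n m_n` as a product of a pair and the exchange of the subtrees. -/
theorem odo_mul_mElt (n : ℕ) : odo (n + 2) (n + 2) * mElt (n + 2) =
    pair (pair (odo n n) (odo n n) * halfSwap n) (halfSwap n) * halfSwap (n + 1) := by
  rw [mElt_add_two, odo_succ_self (n + 1), odo_succ_self n, mul_assoc, halfSwap_mul_pair,
    ← mul_assoc, pair_mul, one_mul, mul_assoc (pair (odo n n) 1), halfSwap_mul_pair, ← mul_assoc,
    pair_mul, mul_one, one_mul]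

theorem cyc_odo_mul_mElt_mul_pair {n : ℕ} (u v : Equiv.Perm (Fin (2 ^ (n + 1)))) :
    cyc (odo (n + 2) (n + 2) * mElt (n + 2) * pair u v) =
      (cyc (pair (odo n n) (odo n n) * (halfSwap n * v * halfSwap n) * u)).map (2 * ·) := by
  rw [odo_mul_mElt, mul_assoc, halfSwap_mul_pair, ← mul_assoc, pair_mul, cyc_pair_mul_halfSwap]
  simp only [mul_assoc]

/-- The element multiplying `u` in `cyc_odo_mul_mElt_mul_pair` lies in `K_(n+1)`. -/
theorem pair_odo_odo_mul_halfSwap_conj_mem {n : ℕ} {v : Equiv.Perm (Fin (2 ^ (n + 1)))}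
    (hv : v ∈ grpK (n + 1)) :
    pair (odo n n) (odo n n) * (halfSwap n * v * halfSwap n) ∈ grpK (n + 1) :=
  mul_mem (pair_odo_odo_mem n) (halfSwap_conj_mem hv)

theorem pair_odo_odo_mul_halfSwap_conj_mul_odo_mem {n : ℕ} {v : Equiv.Perm (Fin (2 ^ (n + 1)))}
    (hv : (odo (n + 1) (n + 1))⁻¹ * v ∈ grpK (n + 1)) :
    pair (odo n n) (odo n n) * (halfSwap n * v * halfSwap n) * odo (n + 1) (n + 1) ∈
      grpK (n + 1) := by
  rw [mul_assoc]
  refine mul_mem (pair_odo_odo_mem n) ?_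
  have h := mul_mem (odo_conj_mem (halfSwap_conj_odo_mul_mem hv)) (odo_sq_mem (n + 1))
  rwa [show ∀ x k : Equiv.Perm (Fin (2 ^ (n + 1))), x * (x⁻¹ * k) * x⁻¹ * (x * x) = k * x by
    intros; group] at h

/-- The cycles are the doubled cycles of an element of `K_(n+1)`, which preserves each half and
therefore has at least two. -/
theorem two_le_card_cyc_odo_mul_mElt_mul {n : ℕ} {k : Equiv.Perm (Fin (2 ^ (n + 2)))}
    (hk : k ∈ grpK (n + 2)) : 2 ≤ (cyc (odo (n + 2) (n + 2) * mElt (n + 2) * k)).card := by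
  obtain ⟨u, v, rfl, h⟩ := mem_grpK_succ.1 hk
  rw [cyc_odo_mul_mElt_mul_pair, Multiset.card_map]
  apply two_le_card_cyc
  rcases h with ⟨hu, hv⟩ | ⟨hu, hv⟩
  · exact mul_mem (pair_odo_odo_mul_halfSwap_conj_mem hv) hu
  · have := mul_mem (pair_odo_odo_mul_halfSwap_conj_mul_odo_mem hv) hu
    rwa [mul_assoc _ (odo (n + 1) (n + 1)), mul_inv_cancel_left] at this

theorem od_grpN (n : ℕ) : od (n + 2) (grpN (n + 2)) = grpK (n + 2) := by
  ext w
  constructor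
  · rintro ⟨hw, hod⟩
    refine (mem_or_of_mem_grpN hw).resolve_right fun h => ?_
    have h2 := two_le_card_cyc_odo_mul_mElt_mul h
    rw [mul_assoc, mul_inv_cancel_left, (isOdometer_iff _).1 hod] at h2
    omega
  · intro hw
    refine ⟨grpK_le_grpN n hw, ?_⟩
    rw [isOdometer_iff, cyc_odo_mul hw, Multiset.card_singleton]

theorem odo_mul_mElt_notMem (n : ℕ) : odo (n + 2) (n + 2) * mElt (n + 2) ∉ grpK (n + 2) := by
  intro h
  obtain ⟨u, v, h, -⟩ := mem_grpK_succ.1 h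
  rw [odo_mul_mElt] at h
  -- The leaf `0` is sent to the right half by `x m`, but stays in the left half under any `pair u
  -- v`.
  have := congrArg (fun w => ((w (leafEquiv (n + 1) (Sum.inl 0))) : ℕ)) h
  simp only [Equiv.Perm.mul_apply, halfSwap_inl, pair_inl, pair_inr, leafEquiv_inl_val,
    leafEquiv_inr_val] at this
  have := (u 0).isLt
  omega

theorem mem_grpM2_add_two {n : ℕ} {w : Equiv.Perm (Fin (2 ^ (n + 2)))} :
    w ∈ grpM2 (n + 2) ↔
      w ∈ grpK (n + 2) ∨ (odo (n + 2) (n + 2) * mElt (n + 2))⁻¹ * w ∈ grpK (n + 2) := by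
  set y := odo (n + 2) (n + 2) * mElt (n + 2) with hy
  have hconj : ∀ k ∈ grpK (n + 2), y * k * y⁻¹ ∈ grpK (n + 2) := by
    intro k hk
    have := odo_conj_mem (mElt_conj_mem hk)
    rwa [show ∀ x m : Equiv.Perm (Fin (2 ^ (n + 2))), x * (m * k * m⁻¹) * x⁻¹ =
      x * m * k * (x * m)⁻¹ by intros; group] at this
  have hsq : y * y ∈ grpK (n + 2) := by
    have := mul_mem (mul_mem (commutator_mem n) (mElt_conj_mem (odo_sq_mem (n + 2))))
      (mElt_sq_mem n)
    rwa [show ∀ x m : Equiv.Perm (Fin (2 ^ (n + 2))),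
      x * m * x⁻¹ * m⁻¹ * (m * (x * x) * m⁻¹) * (m * m) = x * m * (x * m) by
        intros; group] at this
  constructor
  · intro hw
    have hle : grpM2 (n + 2) ≤ adjoinRoot (grpK (n + 2)) y hconj hsq := by
      rw [grpM2, Subgroup.closure_le, od_grpN]
      rintro w (rfl | hw)
      · exact Or.inr (by rw [hy, inv_mul_cancel]; exact one_mem _)
      · exact Or.inl hw
    exact hle hw
  · have hK : grpK (n + 2) ≤ grpM2 (n + 2) := fun k hk =>
      Subgroup.subset_closure (Or.inr (by rw [od_grpN]; exact hk))
    rintro (hw | hw)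
    · exact hK hw
    · have := mul_mem (Subgroup.subset_closure (Or.inl rfl) : y ∈ grpM2 (n + 2)) (hK hw)
      rwa [mul_inv_cancel_left] at this

/-! ### Uniform distributions -/

section Uniform

variable {A B : Type*} [Fintype A] [Nonempty A] [Fintype B] [Nonempty B]

theorem uniformOfFintype_map_of_bijective {f : A → B} (hf : Function.Bijective f) :
    (PMF.uniformOfFintype A).map f = PMF.uniformOfFintype B := by
  classical
  ext b
  obtain ⟨a, rfl⟩ := hf.2 b
  rw [PMF.map_apply, tsum_fintype, Finset.sum_eq_single a]
  · rw [if_pos rfl, PMF.uniformOfFintype_apply, PMF.uniformOfFintype_apply,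
      Fintype.card_of_bijective hf]
  · intro a' _ h
    exact if_neg fun h' => h (hf.1 h').symm
  · intro h
    exact absurd (Finset.mem_univ a) h

theorem uniformOfFintype_prod :
    PMF.uniformOfFintype (A × B) =
      (PMF.uniformOfFintype A).bind fun a => (PMF.uniformOfFintype B).map fun b => (a, b) := by
  classical
  ext ⟨a, b⟩
  have h : ∀ a', ((PMF.uniformOfFintype B).map fun b => (a', b)) (a, b) =
      if a' = a then (Fintype.card B : ENNReal)⁻¹ else 0 := by
    intro a'
    rw [PMF.map_apply, tsum_fintype]
    by_cases ha : a' = a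
    · subst ha
      rw [Finset.sum_eq_single b]
      · simp
      · intro b' _ hb'
        exact if_neg fun h => hb' (Prod.ext_iff.1 h).2.symm
      · intro hb
        exact absurd (Finset.mem_univ b) hb
    · rw [if_neg ha]
      exact Finset.sum_eq_zero fun b' _ => if_neg fun h => ha (Prod.ext_iff.1 h).1.symm
  rw [PMF.bind_apply, tsum_fintype]
  simp only [h, PMF.uniformOfFintype_apply, mul_ite, mul_zero, Finset.sum_ite_eq',
    Finset.mem_univ, if_true, Fintype.card_prod, Nat.cast_mul]
  exact ENNReal.mul_inv (Or.inr (by simp)) (Or.inl (by simp))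

theorem toReal_uniformOfFintype_map_apply {C : Type*} (f : A → C) (c : C) :
    (((PMF.uniformOfFintype A).map f) c).toReal = (Nat.card {a // f a = c} : ℝ) / Nat.card A := by
  classical
  rw [PMF.map_apply, tsum_fintype]
  simp only [PMF.uniformOfFintype_apply]
  rw [← Finset.sum_filter, Finset.sum_const, nsmul_eq_mul, ENNReal.toReal_mul, ENNReal.toReal_inv,
    ENNReal.toReal_natCast, ENNReal.toReal_natCast, Nat.card_eq_fintype_card,
    Nat.card_eq_fintype_card, Fintype.card_subtype, div_eq_mul_inv]
  simp only [eq_comm]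

end Uniform

/-- A fair coin. -/
noncomputable def coin : PMF Bool := PMF.uniformOfFintype Bool

theorem coin_bind_apply {C : Type*} (f : Bool → PMF C) (c : C) :
    (coin.bind f) c = 2⁻¹ * f true c + 2⁻¹ * f false c := by
  rw [PMF.bind_apply, tsum_fintype, Fintype.sum_bool]
  simp [coin]

/-- The distribution of the sum of two independent random multisets. -/
noncomputable def convSum (p q : PMF (Multiset ℕ)) : PMF (Multiset ℕ) :=
  p.bind fun c => q.map (c + ·)

/-- The distribution of the degrees of the descendants after `k` steps of a factor `[ss, d]`. -/
noncomputable def branch : ℕ → ℕ → PMF (Multiset ℕ)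
  | 0, d => PMF.pure {d}
  | k + 1, d => coin.bind fun b =>
      if b then PMF.pure {2 ^ k * d, 2 ^ k * d} else convSum (branch k d) (branch k d)

/-- The process never looks at the degree, so scaling the initial degree scales all the outcomes. -/
theorem branch_map_two_mul (k d : ℕ) :
    (branch k d).map (Multiset.map (2 * ·)) = branch k (2 * d) := by
  induction k with
  | zero => simp [branch, PMF.pure_map]
  | succ k ih =>
    rw [branch, branch, PMF.map_bind]
    congr 1
    funext b
    cases b
    · simp only [Bool.false_eq_true, if_false, convSum, ← ih, PMF.map_bind, PMF.bind_map,
        PMF.map_comp]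
      congr 1
      funext c
      simp only [Function.comp_apply]
      congr 1
      funext e
      simp
    · simp only [if_true, PMF.pure_map]
      simp [mul_left_comm]

/-! ### The degrees in the Markov process -/

/-- The distribution of the degrees after `k` steps of the Markov process started at `L`. -/
noncomputable def degDist : ℕ → Datum → PMF (Multiset ℕ)
  | 0, L => PMF.pure (degrees L)
  | k + 1, L => (step L).bind (degDist k)

theorem iterate_bind_step_map_degrees (k : ℕ) (p : PMF Datum) :
    ((fun D => D.bind step)^[k] p).map degrees = p.bind (degDist k) := by
  induction k generalizing p with
  | zero => rfl
  | succ k ih =>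
    rw [Function.iterate_succ_apply, ih, PMF.bind_bind]
    rfl

theorem step_append (L L' : Datum) :
    step (L ++ L') = (step L).bind fun D => (step L').map (D ++ ·) := by
  induction L with
  | nil => simp only [step, PMF.pure_bind, List.nil_append]; exact (PMF.map_id _).symm
  | cons F L ih =>
    rw [List.cons_append, step, ih, step, PMF.bind_bind]
    congr 1
    funext D
    rw [PMF.map_bind, PMF.bind_map]
    congr 1
    funext E
    rw [PMF.map_comp]
    simp [Function.comp_def]

theorem step_singleton (F : FType × ℕ) : step [F] = children F := by
  simp [step, PMF.pure_map, PMF.bind_pure]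

theorem degrees_append (L L' : Datum) : degrees (L ++ L') = degrees L + degrees L' := by
  simp [degrees]

theorem degDist_append (k : ℕ) (L L' : Datum) :
    degDist k (L ++ L') = convSum (degDist k L) (degDist k L') := by
  induction k generalizing L L' with
  | zero => simp [degDist, convSum, PMF.pure_bind, PMF.pure_map, degrees_append]
  | succ k ih =>
    rw [degDist, step_append, PMF.bind_bind, convSum, degDist, degDist, PMF.bind_bind]
    congr 1
    funext D
    rw [PMF.bind_map]
    simp only [PMF.map_bind]
    -- By independence, the first step of `L'` can be drawn before the later evolution of `D`.
    rw [PMF.bind_comm]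
    congr 1
    funext E
    exact ih D E

theorem children_nn (d : ℕ) : children (nn, d) = PMF.pure [(nn, 2 * d)] := by
  simp [children, nn, act]

theorem allowable_ss : allowable ss = {(nn, nn), (ss, ss)} := by decide

theorem uniformOfFinset_allowable_ss :
    PMF.uniformOfFinset (allowable ss) (allowable_nonempty ss) =
      coin.bind fun b => PMF.pure (if b then (nn, nn) else (ss, ss)) := by
  ext P
  rw [coin_bind_apply, PMF.uniformOfFinset_apply, allowable_ss]
  have hne : ((ss, ss) : FType × FType) ≠ (nn, nn) := by decide
  by_cases h1 : P = (nn, nn)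
  · subst h1
    simp [hne.symm]
  · by_cases h2 : P = (ss, ss)
    · subst h2
      simp [hne, hne.symm]
    · simp [h1, h2]

theorem children_ss (d : ℕ) : children (ss, d) =
    coin.bind fun b => PMF.pure (if b then [(nn, d), (nn, d)] else [(ss, d), (ss, d)]) := by
  rw [children, if_pos (show (ss, d).1.1 = true from rfl), uniformOfFinset_allowable_ss, PMF.map_bind]
  congr 1
  funext b
  rw [PMF.pure_map]
  cases b <;> rfl

theorem degDist_nn (k d : ℕ) : degDist k [(nn, d)] = PMF.pure {2 ^ k * d} := by
  induction k generalizing d with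
  | zero => simp [degDist, degrees]
  | succ k ih =>
    rw [degDist, step_singleton, children_nn, PMF.pure_bind, ih, pow_succ, mul_assoc]

theorem degDist_nn_nn (k d : ℕ) :
    degDist k [(nn, d), (nn, d)] = PMF.pure {2 ^ k * d, 2 ^ k * d} := by
  rw [show [(nn, d), (nn, d)] = [(nn, d)] ++ [(nn, d)] from rfl, degDist_append, degDist_nn, convSum,
    PMF.pure_bind, PMF.pure_map]
  rfl

theorem degDist_ss (k d : ℕ) : degDist k [(ss, d)] = branch k d := by
  induction k with
  | zero => simp [degDist, degrees, branch]
  | succ k ih =>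
    rw [degDist, step_singleton, children_ss, PMF.bind_bind, branch]
    congr 1
    funext b
    rw [PMF.pure_bind]
    cases b
    · simp only [Bool.false_eq_true, if_false]
      rw [show [(ss, d), (ss, d)] = [(ss, d)] ++ [(ss, d)] from rfl, degDist_append, ih]
    · simp only [if_true]
      exact degDist_nn_nn k d

/-- The two weights `1/4` are half of a fair coin: they come from splitting a virtual factor
`[ss,1]` at level `0`. -/
theorem model4_eq : model4 = coin.bind fun b => if b then PMF.pure [(ss, 2)] else
    children (ss, 1) := by
  ext D
  have h4 : (2 : ENNReal)⁻¹ * 2⁻¹ = 4⁻¹ := by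
    rw [← ENNReal.mul_inv (by simp) (by simp)]
    norm_num
  have e : model4 D = firstWeight D := rfl
  rw [e, coin_bind_apply, children_ss, firstWeight]
  simp only [if_true, Bool.false_eq_true, if_false, coin_bind_apply, PMF.pure_apply]
  by_cases h1 : D = [(ss, 2)]
  · subst h1
    simp
  · by_cases h2 : D = [(nn, 1), (nn, 1)]
    · subst h2
      simp [h4, nn, ss]
    · by_cases h3 : D = [(ss, 1), (ss, 1)]
      · subst h3
        simp [h4, nn, ss]
      · simp [h1, h2, h3]

theorem levelData_map_degrees (n : ℕ) : (levelData (n + 1)).map degrees =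
    coin.bind fun b => if b then branch n 2 else branch (n + 1) 1 := by
  rw [levelData, iterate_bind_step_map_degrees, model4_eq, PMF.bind_bind, Nat.add_sub_cancel]
  congr 1
  funext b
  cases b
  · simp only [Bool.false_eq_true, if_false]
    rw [← degDist_ss, degDist, step_singleton]
  · simp only [if_true]
    rw [PMF.pure_bind, degDist_ss]

/-! ### The distribution of the cycle types in `K_n` and `M_n(2)` -/

noncomputable instance (n : ℕ) (G : Subgroup (Equiv.Perm (Fin (2 ^ n)))) : Fintype G :=
  Fintype.ofFinite G

/-- The elements of `K_(n+2)` are the pairs `(u, v)` and `(xu, xv)` with `u, v ∈ K_(n+1)`, where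
`x = x_(n+1)`. -/
def pairOfCoin (n : ℕ) (q : Bool × grpK (n + 1) × grpK (n + 1)) : grpK (n + 2) :=
  if q.1 then ⟨pair (odo (n + 1) (n + 1) * q.2.2) (odo (n + 1) (n + 1) * q.2.1),
    pair_mem_grpK_of_odo (by simp) (by simp)⟩
  else ⟨pair q.2.2 q.2.1, pair_mem_grpK q.2.2.2 q.2.1.2⟩

/-- The two kinds of pairs are disjoint because `x_(n+1) ∉ K_(n+1)`. This fails for `x_0 = 1`, which
is why the parametrization starts at `K_2`. -/
theorem pairOfCoin_bijective (n : ℕ) : Function.Bijective (pairOfCoin n) := by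
  have hx : ∀ u u' : grpK (n + 1),
      (u : Equiv.Perm (Fin (2 ^ (n + 1)))) ≠ odo (n + 1) (n + 1) * u' := by
    intro u u' h
    apply odo_notMem_grpK n
    rw [eq_mul_inv_of_mul_eq h.symm]
    exact mul_mem u.2 (inv_mem u'.2)
  constructor
  · rintro ⟨b, v, u⟩ ⟨b', v', u'⟩ h
    have h := congrArg Subtype.val h
    cases b <;> cases b' <;> simp only [pairOfCoin, Bool.false_eq_true, if_true, if_false,
      pair_inj, mul_right_inj] at h
    · rw [Subtype.ext h.1, Subtype.ext h.2]
    · exact absurd h.1 (hx _ _)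
    · exact absurd h.1.symm (hx _ _)
    · rw [Subtype.ext h.1, Subtype.ext h.2]
  · rintro ⟨w, hw⟩
    obtain ⟨u, v, rfl, ⟨hu, hv⟩ | ⟨hu, hv⟩⟩ := mem_grpK_succ.1 hw
    · exact ⟨(false, ⟨v, hv⟩, ⟨u, hu⟩), by simp [pairOfCoin]⟩
    · exact ⟨(true, ⟨_, hv⟩, ⟨_, hu⟩), by simp [pairOfCoin]⟩

theorem uniformOfFintype_grpK_map {C : Type*} (n : ℕ) (f : grpK (n + 2) → C) :
    (PMF.uniformOfFintype (grpK (n + 2))).map f = coin.bind fun b =>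
      (PMF.uniformOfFintype (grpK (n + 1))).bind fun v =>
        (PMF.uniformOfFintype (grpK (n + 1))).map fun u => f (pairOfCoin n (b, v, u)) := by
  rw [← uniformOfFintype_map_of_bijective (pairOfCoin_bijective n), PMF.map_comp,
    uniformOfFintype_prod, uniformOfFintype_prod]
  simp only [PMF.map_bind, PMF.map_comp]
  rfl

theorem uniformOfFintype_grpK_map_cyc (n : ℕ) :
    (PMF.uniformOfFintype (grpK n)).map (fun k : grpK n => cyc (k : Equiv.Perm (Fin (2 ^ n)))) =
      branch n 1 := by
  induction n with
  | zero =>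
    simp only [cyc_zero]
    exact PMF.map_const _ _
  | succ n ih =>
    -- In `K_1` the two kinds of pairs coincide, so there is no coin to match; but both outcomes of
    -- the coin in `branch 1 1` are `{1, 1}`.
    rcases n with _ | n
    · have h : ∀ k : grpK 1, cyc (k : Equiv.Perm (Fin (2 ^ 1))) = {1, 1} := by
        rintro ⟨k, hk⟩
        obtain ⟨u, v, rfl, -⟩ := mem_grpK_succ.1 hk
        rw [cyc_pair, cyc_zero, cyc_zero]
        rfl
      simp only [h]
      rw [branch]
      have h' : ∀ b : Bool, (if b then PMF.pure {2 ^ 0 * 1, 2 ^ 0 * 1} else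
          convSum (branch 0 1) (branch 0 1)) = PMF.pure ({1, 1} : Multiset ℕ) := by
        intro b
        cases b
        · simp only [Bool.false_eq_true, if_false, convSum, branch, PMF.pure_bind, PMF.pure_map]
          rfl
        · simp
      simp only [h', PMF.bind_const]
      exact PMF.map_const _ _
    · rw [uniformOfFintype_grpK_map, branch]
      congr 1
      funext b
      cases b
      · simp only [pairOfCoin, Bool.false_eq_true, if_false, cyc_pair, convSum, ← ih, PMF.bind_map,
          PMF.map_comp]
        congr 1
        funext v
        congr 1
        funext u
        simp [add_comm]
      · simp only [pairOfCoin, if_true, cyc_pair, cyc_odo_mul (Subtype.prop _), mul_one]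
        rw [show (fun _ : grpK (n + 1) => (PMF.uniformOfFintype (grpK (n + 1))).map
          fun _ : grpK (n + 1) => ({2 ^ (n + 1)} : Multiset ℕ) + {2 ^ (n + 1)}) =
          fun _ => PMF.pure {2 ^ (n + 1), 2 ^ (n + 1)} from
            funext fun _ => PMF.map_const _ _, PMF.bind_const]

theorem uniformOfFintype_subgroup_map_mul_left {G C : Type*} [Group G] (K : Subgroup G) [Fintype K]
    {t : G} (ht : t ∈ K) (f : G → C) :
    (PMF.uniformOfFintype K).map (fun u : K => f (t * u)) =
      (PMF.uniformOfFintype K).map (fun u : K => f u) := by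
  conv_rhs => rw [← uniformOfFintype_map_of_bijective (Group.mulLeft_bijective (⟨t, ht⟩ : K)),
    PMF.map_comp]
  rfl

/-- For each fixed coin `b` and entry `v`, the type is the double of that of `t * u` with `t ∈
K_(n+1)` and `u` uniform in `K_(n+1)`. Translation by `t` preserves the uniform law, so neither `b`
nor `v` affects the distribution. -/
theorem uniformOfFintype_grpK_map_cyc_odo_mul_mElt_mul (n : ℕ) :
    (PMF.uniformOfFintype (grpK (n + 2))).map (fun k : grpK (n + 2) => cyc
      (odo (n + 2) (n + 2) * mElt (n + 2) * (k : Equiv.Perm (Fin (2 ^ (n + 2)))))) =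
        branch (n + 1) 2 := by
  rw [uniformOfFintype_grpK_map]
  have h : ∀ t ∈ grpK (n + 1), (PMF.uniformOfFintype (grpK (n + 1))).map
      (fun u : grpK (n + 1) => (cyc (t * (u : Equiv.Perm (Fin (2 ^ (n + 1)))))).map (2 * ·)) =
        branch (n + 1) 2 := by
    intro t ht
    rw [uniformOfFintype_subgroup_map_mul_left _ ht fun u => (cyc u).map (2 * ·)]
    rw [show branch (n + 1) 2 = _ from (branch_map_two_mul (n + 1) 1).symm,
      ← uniformOfFintype_grpK_map_cyc, PMF.map_comp]
    rfl
  have hcoin : ∀ (b : Bool) (v : grpK (n + 1)), (PMF.uniformOfFintype (grpK (n + 1))).map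
      (fun u => cyc (odo (n + 2) (n + 2) * mElt (n + 2) *
        (pairOfCoin n (b, v, u) : Equiv.Perm (Fin (2 ^ (n + 2)))))) = branch (n + 1) 2 := by
    intro b v
    cases b
    · simp only [pairOfCoin, Bool.false_eq_true, if_false, cyc_odo_mul_mElt_mul_pair]
      exact h _ (pair_odo_odo_mul_halfSwap_conj_mem v.2)
    · have hv : (odo (n + 1) (n + 1))⁻¹ * (odo (n + 1) (n + 1) * (v : Equiv.Perm _)) ∈
          grpK (n + 1) := by
        rw [inv_mul_cancel_left]
        exact v.2
      rw [← h _ (pair_odo_odo_mul_halfSwap_conj_mul_odo_mem hv)]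
      congr 1
      funext u
      simp only [pairOfCoin, if_true]
      rw [cyc_odo_mul_mElt_mul_pair, mul_assoc _ (odo (n + 1) (n + 1)) (u : Equiv.Perm _)]
  simp only [hcoin, PMF.bind_const]

/-- The uniform distribution on a group `K ∪ yK`. -/
theorem uniformOfFintype_map_of_mem_iff {H C : Type*} [Group H] {G K : Subgroup H} [Fintype G]
    [Fintype K] {y : H} (hy : y ∉ K) (hG : ∀ w, w ∈ G ↔ w ∈ K ∨ y⁻¹ * w ∈ K) (f : H → C) :
    (PMF.uniformOfFintype G).map (fun w : G => f w) = coin.bind fun b =>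
      if b then (PMF.uniformOfFintype K).map (fun k : K => f (y * k))
      else (PMF.uniformOfFintype K).map (fun k : K => f k) := by
  have hyk : ∀ k : K, y * k ∈ G := fun k => (hG _).2 (Or.inr (by simp))
  have hk : ∀ k : K, (k : H) ∈ G := fun k => (hG _).2 (Or.inl k.2)
  let e : Bool × K → G := fun q => if q.1 then ⟨y * q.2, hyk q.2⟩ else ⟨q.2, hk q.2⟩
  have hne : ∀ k k' : K, (k : H) ≠ y * k' := by
    intro k k' h
    apply hy
    rw [eq_mul_inv_of_mul_eq h.symm]
    exact mul_mem k.2 (inv_mem k'.2)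
  have he : Function.Bijective e := by
    constructor
    · rintro ⟨b, k⟩ ⟨b', k'⟩ h
      have h := congrArg Subtype.val h
      cases b <;> cases b' <;> simp only [e, Bool.false_eq_true, if_true, if_false,
        mul_right_inj] at h
      · rw [Subtype.ext h]
      · exact absurd h (hne _ _)
      · exact absurd h.symm (hne _ _)
      · rw [Subtype.ext h]
    · rintro ⟨w, hw⟩
      rcases (hG w).1 hw with h | h
      · exact ⟨(false, ⟨w, h⟩), by simp [e]⟩
      · exact ⟨(true, ⟨_, h⟩), by simp [e]⟩
  rw [← uniformOfFintype_map_of_bijective he, PMF.map_comp, uniformOfFintype_prod, PMF.map_bind,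
    coin]
  congr 1
  funext b
  rw [PMF.map_comp]
  cases b <;> rfl

theorem mem_grpK_one {w : Equiv.Perm (Fin (2 ^ 1))} : w ∈ grpK 1 ↔ w = 1 := by
  have h0 : ∀ u : Equiv.Perm (Fin (2 ^ 0)), u = 1 := fun u =>
    Equiv.ext fun i => Subsingleton.elim (α := Fin 1) _ _
  refine ⟨fun h => ?_, fun h => h ▸ one_mem _⟩
  obtain ⟨u, v, rfl, -⟩ := mem_grpK_succ.1 h
  rw [h0 u, h0 v, pair_one]

theorem perm_fin_two_eq (w : Equiv.Perm (Fin (2 ^ 1))) : w = 1 ∨ w = odo 1 1 := by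
  revert w
  decide

theorem mem_grpM2_one (w : Equiv.Perm (Fin (2 ^ 1))) :
    w ∈ grpM2 1 ↔ w ∈ grpK 1 ∨ (odo 1 1)⁻¹ * w ∈ grpK 1 := by
  rw [mem_grpK_one, mem_grpK_one, inv_mul_eq_one, eq_comm (a := odo 1 1)]
  refine ⟨fun _ => perm_fin_two_eq w, ?_⟩
  rintro (rfl | rfl)
  · exact one_mem _
  · exact Subgroup.subset_closure (Or.inl (mul_one _).symm)

theorem uniformOfFintype_grpM2_map_cyc (n : ℕ) :
    (PMF.uniformOfFintype (grpM2 (n + 1))).map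
      (fun w : grpM2 (n + 1) => cyc (w : Equiv.Perm (Fin (2 ^ (n + 1))))) =
        (levelData (n + 1)).map degrees := by
  rw [levelData_map_degrees]
  rcases n with _ | n
  -- At height `1`, `m_1 = 1` and the group is all of `S_2`, with `K_1` trivial and `x_1` the
  -- transposition.
  · rw [uniformOfFintype_map_of_mem_iff (odo_notMem_grpK 0) mem_grpM2_one cyc]
    congr 1
    funext b
    cases b
    · exact uniformOfFintype_grpK_map_cyc 1
    · simp only [if_true, cyc_odo_mul (Subtype.prop _)]
      exact PMF.map_const _ _
  · rw [uniformOfFintype_map_of_mem_iff (odo_mul_mElt_notMem n) (fun w => mem_grpM2_add_two) cyc]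
    congr 1
    funext b
    cases b
    · exact uniformOfFintype_grpK_map_cyc (n + 2)
    · exact uniformOfFintype_grpK_map_cyc_odo_mul_mElt_mul n

/-- The uniform law has full support, so the types that occur are those of positive probability, and
proportions are probabilities. -/
theorem cycleData_grpM2 (n : ℕ) : cycleData (grpM2 (n + 1)) = levelCycleData (n + 1) := by
  ext ⟨c, r⟩
  simp only [cycleData, levelCycleData, ← uniformOfFintype_grpM2_map_cyc, Set.mem_ofPred_eq,
    toReal_uniformOfFintype_map_apply, PMF.mem_support_map_iff, PMF.mem_support_uniformOfFintype,
    true_and, Subtype.exists, exists_prop]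

end EvenMarkov

theorem corollary5p18 (a b : ℤ) (hab : a = 2 + b ^ 2 ∨ a = 2 - b ^ 2)
    (hirr : Irreducible (EvenMarkov.gPoly a)) :
    (∀ (p : ℕ) [Fact p.Prime], p % 4 = 1 →
      ∃ D ∈ EvenMarkov.firstLevel, EvenMarkov.factType a p = (D : Multiset (EvenMarkov.FType × ℕ))) ∧
    ∀ n : ℕ, 1 ≤ n →
      EvenMarkov.grpM2 n ≤ EvenMarkov.treeAut n ∧
      EvenMarkov.cycleData (EvenMarkov.grpM2 n) = EvenMarkov.levelCycleData n := by
  refine ⟨fun p _ hp => EvenMarkov.factType_mem_firstLevel a b hab p hp, fun n hn => ?_⟩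
  obtain ⟨n, rfl⟩ := Nat.exists_eq_add_of_le' hn
  exact ⟨EvenMarkov.grpM2_le_treeAut _, EvenMarkov.cycleData_grpM2 n⟩
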